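/- Let $G$ be a locally compact Hausdorff étale groupoid with unit space $G^{(0)}$, domain map $d$ and range map $r$, and assume that $G$ is effective, i.e. $G^{(0)}$ is the interior of the isotropy $\{\alpha\in G : d(\alpha)=r(\alpha)\}$. Let $C_c(G)$ be the $*$-algebra of compactly supported continuous functions $G\to\mathbb{C}$ with $(f*g)(\gamma)=\sum_{\alpha\beta=\gamma}f(\alpha)g(\beta)$ and $f^*(\gamma)=\overline{f(\gamma^{-1})}$; for $x\in G^{(0)}$ and $G_x=d^{-1}(x)$ let $\lambda_x\colon C_c(G)\to B(\ell^2(G_x))$ be the left regular representation, $\lambda_x(f)\delta_\alpha=\sum_{\beta\in G_{r(\alpha)}}f(\beta)\delta_{\beta\alpha}$; let $C^*_r(G)$ be the completion of $C_c(G)$ in the reduced norm $\|f\|_r=\sup_{x\in G^{(0)}}\|\lambda_x(f)\|$, and let $C_0(G^{(0)})\subset C^*_r(G)$ be the closure of $C_c(G^{(0)})\subset C_c(G)$ (the functions in $C_c(G)$ that vanish off $G^{(0)}$). Let $\mathrm{Aut}_{C_0(G^{(0)})}(C^*_r(G))$ be the group of all $*$-automorphisms $\varphi$ of $C^*_r(G)$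 with $\varphi(C_0(G^{(0)}))=C_0(G^{(0)})$. Let $\mathrm{Aut}(G)$ be the group of groupoid automorphisms of $G$ that are homeomorphisms, let $Z(G,\mathbb{T})$ be the abelian group, under the pointwise product, of continuous groupoid homomorphisms $c\colon G\to\mathbb{T}$ into the circle group, let $\mathrm{Aut}(G)$ act on $Z(G,\mathbb{T})$ by $(\Phi.c)(\alpha)=c(\Phi^{-1}(\alpha))$, and let $\mathrm{Aut}(G)\ltimes Z(G,\mathbb{T})$ be the set of pairs $(\Phi,c)$ with the group law $(\Phi_1,c_1)(\Phi_2,c_2)=(\Phi_1\circ\Phi_2,\ (\Phi_2^{-1}.c_1)\,c_2)$. Then for every $\Phi\in\mathrm{Aut}(G)$ and $c\in Z(G,\mathbb{T})$ there is a unique $*$-automorphism $\varphi_{\Phi,c}$ of $C^*_r(G)$ such that $$\varphi_{\Phi,c}(f)(\alpha)=c(\Phi^{-1}(\alpha))\,f(\Phi^{-1}(\alpha))\qquad (f\in C_c(G),\ \alpha\in G).$$ It belongs to $\mathrm{Aut}_{C_0(G^{(0)})}(C^*_r(G))$, and the map $$\Psi\colon \mathrm{Aut}(G)\ltimes Z(G,\mathbb{T})\to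 \mathrm{Aut}_{C_0(G^{(0)})}(C^*_r(G)),\qquad (\Phi,c)\mapsto\varphi_{\Phi,c},$$ is an isomorphism of groups. -/

import Mathlib

open scoped ENNReal CompactlySupported Topology
open Filter

set_option linter.unusedSectionVars false

/-- A (small) groupoid, given as a set `G` of arrows with a distinguished subset of units, domain
and range maps with values in the units, a partial multiplication and an inversion.  The product
`mul α β` is only meaningful for composable pairs, i.e. if `d α = r β`; the laws say nothing about
its values elsewhere, and nothing below uses them. -/
class ArrowGroupoid (G : Type*) where
  units : Set G
  d : G → G
  r : G → G
  mul : G → G → G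
  inv : G → G
  d_mem : ∀ α, d α ∈ units
  r_mem : ∀ α, r α ∈ units
  d_unit : ∀ x ∈ units, d x = x
  r_unit : ∀ x ∈ units, r x = x
  mul_d : ∀ α, mul α (d α) = α
  r_mul : ∀ α, mul (r α) α = α
  d_mul' : ∀ α β, d α = r β → d (mul α β) = d β
  r_mul' : ∀ α β, d α = r β → r (mul α β) = r α
  assoc : ∀ α β γ, d α = r β → d β = r γ → mul (mul α β) γ = mul α (mul β γ)
  d_inv : ∀ γ, d (inv γ) = r γ
  r_inv : ∀ γ, r (inv γ) = d γ
  inv_mul : ∀ γ, mul (inv γ) γ = d γ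
  mul_inv : ∀ γ, mul γ (inv γ) = r γ

namespace ArrowGroupoid

/-- A topological groupoid (multiplication, on the set of composable pairs, and inversion are
continuous) is étale if the domain map `d : G → G⁽⁰⁾` is a local homeomorphism. -/
class IsEtale (G : Type*) [TopologicalSpace G] [ArrowGroupoid G] : Prop where
  continuousOn_mul : ContinuousOn (fun p : G × G => mul p.1 p.2) {p | d p.1 = r p.2}
  continuous_inv : Continuous (inv : G → G)
  isLocalHomeomorph_d : IsLocalHomeomorph (fun α : G => (⟨d α, d_mem α⟩ : units (G := G)))

/-- The isotropy of a groupoid. -/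
def iso (G : Type*) [ArrowGroupoid G] : Set G := {α | d α = r α}

/-- `G` is effective if the unit space is the interior of the isotropy. -/
def IsEffective (G : Type*) [TopologicalSpace G] [ArrowGroupoid G] : Prop :=
  interior (iso G) = units

/-! ### Elementary algebra -/

section Algebra

variable {G : Type*} [ArrowGroupoid G]

theorem inv_mul_cancel_left {α β : G} (h : d α = r β) : mul (inv α) (mul α β) = β := by
  rw [← assoc _ _ _ (d_inv α |>.trans rfl) h, inv_mul, h, r_mul]

theorem mul_inv_cancel_left {α β : G} (h : r α = r β) : mul α (mul (inv α) β) = β := by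
  rw [← assoc _ _ _ (r_inv α).symm ((d_inv α).trans h), mul_inv, h, r_mul]

theorem mul_inv_cancel_right {α β : G} (h : d α = r β) : mul (mul α β) (inv β) = α := by
  rw [assoc _ _ _ h (r_inv β).symm, mul_inv, ← h, mul_d]

theorem inv_mul_cancel_right {α β : G} (h : d α = d β) : mul (mul α (inv β)) β = α := by
  rw [assoc _ _ _ (h.trans (r_inv β).symm) (d_inv β), inv_mul, ← h, mul_d]

theorem d_mul_inv {α β : G} (h : d α = d β) : d (mul α (inv β)) = r β := by
  rw [d_mul' _ _ (h.trans (r_inv β).symm), d_inv]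

theorem r_mul_inv {α β : G} (h : d α = d β) : r (mul α (inv β)) = r α :=
  r_mul' _ _ (h.trans (r_inv β).symm)

theorem d_inv_mul {α β : G} (h : r α = r β) : d (mul (inv α) β) = d β :=
  d_mul' _ _ ((d_inv α).trans h)

theorem r_inv_mul {α β : G} (h : r α = r β) : r (mul (inv α) β) = d α := by
  rw [r_mul' _ _ ((d_inv α).trans h), r_inv]

theorem eq_inv_of_mul_eq {α β : G} (h : d α = r β) (h' : mul α β ∈ units) : α = inv β := by
  have h1 : mul α β = d β := by rw [← d_mul' α β h, d_unit _ h']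
  have h2 := mul_inv_cancel_right h
  rw [h1, ← r_inv β, r_mul] at h2
  exact h2.symm

theorem inv_inv' (γ : G) : inv (inv γ) = γ := by
  refine (eq_inv_of_mul_eq (r_inv γ).symm ?_).symm
  rw [mul_inv]; exact r_mem γ

theorem mul_inv_rev {α β : G} (h : d α = d β) : inv (mul α (inv β)) = mul β (inv α) := by
  refine (eq_inv_of_mul_eq ?_ ?_).symm
  · rw [d_mul_inv h.symm, r_mul_inv h]
  · rw [← assoc _ _ _ ((d_mul_inv h.symm).trans rfl) (h.trans (r_inv β).symm),
      inv_mul_cancel_right h.symm, mul_inv]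
    exact r_mem β

theorem inv_unit {x : G} (hx : x ∈ units) : inv x = x := by
  refine (eq_inv_of_mul_eq ?_ ?_).symm
  · rw [d_unit _ hx, r_unit _ hx]
  · have := mul_d x
    rw [d_unit _ hx] at this
    rwa [this]

theorem r_mul_of_eq {x α : G} (h : x = r α) : mul x α = α := by rw [h, r_mul]

theorem mul_mem_units {x y : G} (hx : x ∈ units) (hy : y ∈ units) (h : d x = r y) :
    mul x y ∈ units := by
  rw [d_unit _ hx] at h
  rwa [r_mul_of_eq h]

theorem mem_units_of_mul_self {x : G} (h : d x = r x) (h' : mul x x = x) : x ∈ units := by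
  have := inv_mul_cancel_left h
  rw [h', inv_mul] at this
  rw [← this]; exact d_mem x

/-- The pairs `(α, β)` with `α β = γ` are parametrised by the `α` with the same range as `γ`. -/
def factorEquiv (γ : G) :
    {α : G // r α = r γ} ≃ {p : G × G // d p.1 = r p.2 ∧ mul p.1 p.2 = γ} where
  toFun α := ⟨(α.1, mul (inv α.1) γ), (r_inv_mul α.2).symm, mul_inv_cancel_left α.2⟩
  invFun p := ⟨p.1.1, (r_mul' _ _ p.2.1).symm.trans (congrArg r p.2.2)⟩
  left_inv α := rfl
  right_inv := by
    rintro ⟨⟨α, β⟩, h, rfl⟩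
    simp only [Subtype.mk.injEq, Prod.mk.injEq, true_and]
    exact inv_mul_cancel_left h

/-- For `γ ∈ G_x`, the map `β ↦ γ β⁻¹` is a bijection of `G_x` onto `G^{r(γ)}`. -/
def fibreEquiv {γ x : G} (hγ : d γ = x) {y : G} (hy : r γ = y) :
    {β : G // d β = x} ≃ {α : G // r α = y} where
  toFun β := ⟨mul γ (inv β.1), by rw [r_mul_inv (hγ.trans β.2.symm), hy]⟩
  invFun α := ⟨mul (inv α.1) γ, by rw [d_inv_mul (α.2.trans hy.symm), hγ]⟩
  left_inv := by
    rintro ⟨β, hβ⟩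
    have h : d γ = d β := hγ.trans hβ.symm
    ext1
    simp only
    rw [mul_inv_rev h, inv_mul_cancel_right h.symm]
  right_inv := by
    rintro ⟨α, hα⟩
    have h : r α = r γ := hα.trans hy.symm
    ext1
    simp only
    have h1 : inv (mul (inv α) γ) = mul (inv γ) α := by
      refine (eq_inv_of_mul_eq ?_ ?_).symm
      · rw [d_inv_mul h.symm, r_inv_mul h]
      · rw [← assoc _ _ _ ((d_inv_mul h.symm).trans (r_inv α).symm) ((d_inv α).trans h),
          mul_inv_cancel_right ((d_inv γ).trans h.symm), inv_mul]
        exact d_mem γ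
    rw [h1, mul_inv_cancel_left h.symm]

end Algebra

/-! ### Topology -/

section Topology

variable {G : Type*} [TopologicalSpace G] [ArrowGroupoid G] [IsEtale G]

variable (G) in
/-- The inversion as a homeomorphism. -/
def invHomeo : G ≃ₜ G where
  toFun := inv
  invFun := inv
  left_inv := inv_inv'
  right_inv := inv_inv'
  continuous_toFun := IsEtale.continuous_inv
  continuous_invFun := IsEtale.continuous_inv

variable (G) in
theorem isLocalHomeomorph_r :
    IsLocalHomeomorph (fun α : G => (⟨r α, r_mem α⟩ : units (G := G))) := by
  have h := (IsEtale.isLocalHomeomorph_d (G := G)).comp (invHomeo G).isLocalHomeomorph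
  have e : (fun α : G => (⟨r α, r_mem α⟩ : units (G := G))) =
      (fun α : G => (⟨d α, d_mem α⟩ : units (G := G))) ∘ (invHomeo G) := by
    funext α
    exact Subtype.ext (d_inv α).symm
  rwa [e]

theorem continuous_d : Continuous (d : G → G) :=
  continuous_subtype_val.comp (IsEtale.isLocalHomeomorph_d (G := G)).continuous

theorem continuous_r : Continuous (r : G → G) :=
  continuous_subtype_val.comp (isLocalHomeomorph_r G).continuous

/-- A compact set meets the fibres of a local homeomorphism in a bounded number of points. -/
theorem exists_card_le {X Y : Type*} [TopologicalSpace X] [TopologicalSpace Y] {p : X → Y}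
    (hp : IsLocalHomeomorph p) {K : Set X} (hK : IsCompact K) :
    ∃ N : ℕ, ∀ y, ∃ t : Finset X, t.card ≤ N ∧ ∀ x ∈ K, p x = y → x ∈ t := by
  classical
  choose e he hpe using hp
  obtain ⟨t, -, ht⟩ := hK.elim_nhds_subcover (fun x => (e x).source)
    (fun x _ => (e x).open_source.mem_nhds (he x))
  refine ⟨t.card, fun y => ?_⟩
  refine ⟨t.image (fun x => (e x).symm y), Finset.card_image_le, fun x hx hxy => ?_⟩
  obtain ⟨z, hz, hxz⟩ := Set.mem_iUnion₂.1 (ht hx)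
  refine Finset.mem_image.2 ⟨z, hz, ?_⟩
  rw [← hxy, hpe z, (e z).left_inv hxz]

end Topology

/-! ### The *-algebra `C_c(G)` -/

section Convolution

variable {G : Type*} [TopologicalSpace G] [ArrowGroupoid G]

/-- The convolution product `(f * g)(γ) = ∑_{αβ = γ} f(α) g(β)`. -/
noncomputable def convFun (f g : G → ℂ) (γ : G) : ℂ :=
  ∑' p : {p : G × G // d p.1 = r p.2 ∧ mul p.1 p.2 = γ}, f p.1.1 * g p.1.2

theorem convFun_eq (f g : G → ℂ) (γ : G) :
    convFun f g γ = ∑' α : {α : G // r α = r γ}, f α * g (mul (inv α.1) γ) :=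
  ((factorEquiv γ).tsum_eq
    (fun p : {p : G × G // d p.1 = r p.2 ∧ mul p.1 p.2 = γ} => f p.1.1 * g p.1.2)).symm

theorem exists_of_convFun_ne {f g : G → ℂ} {γ : G} (h : convFun f g γ ≠ 0) :
    ∃ α β, d α = r β ∧ mul α β = γ ∧ f α ≠ 0 ∧ g β ≠ 0 := by
  by_contra hc
  push Not at hc
  apply h
  rw [convFun]
  convert tsum_zero with p
  obtain ⟨⟨α, β⟩, h1, h2⟩ := p
  by_cases hf : f α = 0
  · simp [hf]
  · simp [hc α β h1 h2 hf]

variable [IsEtale G] [T2Space G]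

theorem hasCompactSupport_convFun (f g : C_c(G, ℂ)) : HasCompactSupport (convFun f g) := by
  have hK : IsCompact ((tsupport f ×ˢ tsupport g) ∩ {p : G × G | d p.1 = r p.2}) :=
    (f.hasCompactSupport.prod g.hasCompactSupport).inter_right
      (isClosed_eq (continuous_d.comp continuous_fst) (continuous_r.comp continuous_snd))
  have hK' := hK.image_of_continuousOn
    ((IsEtale.continuousOn_mul (G := G)).mono Set.inter_subset_right)
  refine HasCompactSupport.intro hK' fun γ hγ => ?_
  by_contra h
  obtain ⟨α, β, h1, h2, h3, h4⟩ := exists_of_convFun_ne h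
  exact hγ ⟨(α, β), ⟨⟨subset_tsupport _ h3, subset_tsupport _ h4⟩, h1⟩, h2⟩

theorem continuous_convFun (f g : C_c(G, ℂ)) : Continuous (convFun f g) := by
  classical
  rw [continuous_iff_continuousAt]
  intro γ₀
  set p : G → units (G := G) := fun α => ⟨r α, r_mem α⟩ with hp_def
  have hp : IsLocalHomeomorph p := isLocalHomeomorph_r G
  have hpc : Continuous p := hp.continuous
  have pr : ∀ {α β : G}, p α = p β ↔ r α = r β := fun {α β} => by simp [hp_def]
  obtain ⟨N, hN⟩ := exists_card_le hp f.hasCompactSupport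
  obtain ⟨t, -, ht⟩ := hN (p γ₀)
  set S : Finset G := t.filter (fun α => p α = p γ₀) with hS
  have hS1 : ∀ α ∈ S, p α = p γ₀ := fun α hα => (Finset.mem_filter.1 hα).2
  have hS2 : ∀ α ∈ tsupport f, p α = p γ₀ → α ∈ S := fun α hα h =>
    Finset.mem_filter.2 ⟨ht α hα h, h⟩
  obtain ⟨U, hU, hUd⟩ := S.finite_toSet.t2_separation
  choose e he hpe using hp
  -- local sections of the range map through the points of `S`
  have hsrc : ∀ α ∈ S, ∀ᶠ γ in 𝓝 γ₀, p γ ∈ (e α).target ∧ (e α).symm (p γ) ∈ U α := by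
    intro α hα
    have h0 : p γ₀ ∈ (e α).target := by
      rw [← hS1 α hα, hpe α]; exact (e α).map_source (he α)
    have h1 : (e α).symm (p γ₀) = α := by
      rw [← hS1 α hα]; nth_rewrite 1 [hpe α]; exact (e α).left_inv (he α)
    have hc : Tendsto (fun γ => (e α).symm (p γ)) (𝓝 γ₀) (𝓝 α) := by
      have := ((e α).continuousAt_symm h0).tendsto.comp hpc.continuousAt.tendsto
      rwa [h1] at this
    exact (hpc.continuousAt.eventually ((e α).open_target.mem_nhds h0)).and
      (hc.eventually ((hU α).2.mem_nhds (hU α).1))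
  have hlim : ∀ α ∈ S, Tendsto (fun γ => (e α).symm (p γ)) (𝓝 γ₀) (𝓝 α) := by
    intro α hα
    have h0 : p γ₀ ∈ (e α).target := by
      rw [← hS1 α hα, hpe α]; exact (e α).map_source (he α)
    have h1 : (e α).symm (p γ₀) = α := by
      rw [← hS1 α hα]; nth_rewrite 1 [hpe α]; exact (e α).left_inv (he α)
    have := ((e α).continuousAt_symm h0).tendsto.comp hpc.continuousAt.tendsto
    rwa [h1] at this
  have hout : ∀ᶠ γ in 𝓝 γ₀, ∀ β ∈ tsupport f, p β = p γ →
      ∃ α ∈ S, β ∈ U α ∩ (e α).source := by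
    have hK : IsCompact (tsupport f \ ⋃ α ∈ S, U α ∩ (e α).source) :=
      f.hasCompactSupport.isCompact.diff
        (isOpen_biUnion fun α _ => (hU α).2.inter (e α).open_source)
    have hcl : IsClosed (p '' (tsupport f \ ⋃ α ∈ S, U α ∩ (e α).source)) :=
      (hK.image hpc).isClosed
    have hmem : p γ₀ ∈ (p '' (tsupport f \ ⋃ α ∈ S, U α ∩ (e α).source))ᶜ := by
      rintro ⟨β, ⟨hβ, hβ'⟩, hβp⟩
      exact hβ' (Set.mem_biUnion (hS2 β hβ hβp) ⟨(hU β).1, he β⟩)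
    filter_upwards [hpc.continuousAt.eventually (hcl.isOpen_compl.mem_nhds hmem)]
      with γ hγ β hβ hβγ
    by_contra hc
    push Not at hc
    refine hγ ⟨β, ⟨hβ, fun hβ' => ?_⟩, hβγ⟩
    obtain ⟨α, hα, h⟩ := Set.mem_iUnion₂.1 hβ'
    exact hc α hα h
  have key : ∀ᶠ γ in 𝓝 γ₀, convFun f g γ =
      ∑ α ∈ S, f ((e α).symm (p γ)) * g (mul (inv ((e α).symm (p γ))) γ) := by
    filter_upwards [hout, (Filter.eventually_all_finset S).2 hsrc] with γ h1 h2
    rw [convFun_eq]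
    refine (tsum_subtype {α : G | r α = r γ} (fun α => f α * g (mul (inv α) γ))).trans ?_
    have hinj : Set.InjOn (fun α => (e α).symm (p γ)) S := by
      intro α hα β hβ h
      by_contra hne
      have hd := hUd hα hβ hne
      have hαU := (h2 α hα).2
      simp only at h
      rw [h] at hαU
      exact Set.disjoint_left.1 hd hαU (h2 β hβ).2
    have hr : ∀ α ∈ S, r ((e α).symm (p γ)) = r γ := by
      intro α hα
      rw [← pr]
      nth_rewrite 1 [hpe α]
      exact (e α).right_inv (h2 α hα).1
    rw [tsum_eq_sum (s := S.image (fun α => (e α).symm (p γ))), Finset.sum_image hinj]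
    · refine Finset.sum_congr rfl fun α hα => ?_
      rw [Set.indicator_of_mem]
      exact hr α hα
    · intro β hβ
      by_cases hβr : r β = r γ
      · rw [Set.indicator_of_mem (show β ∈ {α : G | r α = r γ} from hβr)]
        by_cases hf : f β = 0
        · simp [hf]
        · exfalso
          obtain ⟨α, hα, -, hβs⟩ := h1 β (subset_tsupport _ hf) (pr.2 hβr)
          refine hβ (Finset.mem_image.2 ⟨α, hα, ?_⟩)

          rw [← pr.2 hβr]
          nth_rewrite 1 [hpe α]
          exact (e α).left_inv hβs
      · rw [Set.indicator_of_notMem]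
        exact hβr
  have hval : convFun f g γ₀ =
      ∑ α ∈ S, f ((e α).symm (p γ₀)) * g (mul (inv ((e α).symm (p γ₀))) γ₀) := key.self_of_nhds
  rw [ContinuousAt, tendsto_congr' key, hval]
  refine tendsto_finsetSum _ fun α hα => ?_
  have h1 : (e α).symm (p γ₀) = α := by
    rw [← hS1 α hα]; nth_rewrite 1 [hpe α]; exact (e α).left_inv (he α)
  rw [h1]
  refine ((f.continuous.tendsto α).comp (hlim α hα)).mul ((g.continuous.tendsto _).comp ?_)
  have hrα : d (inv α) = r γ₀ := by rw [d_inv, pr.1 (hS1 α hα)]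
  have hm := (IsEtale.continuousOn_mul (G := G)) (inv α, γ₀) hrα
  refine hm.tendsto.comp (f := fun γ => ((inv ((e α).symm (p γ)), γ) : G × G))
    (tendsto_nhdsWithin_iff.2 ⟨?_, ?_⟩)
  · exact (((IsEtale.continuous_inv (G := G)).tendsto α).comp (hlim α hα)).prodMk_nhds tendsto_id
  · filter_upwards [hsrc α hα] with γ hγ

    rw [d_inv, ← pr]
    nth_rewrite 1 [hpe α]
    exact (e α).right_inv hγ.1

/-- The convolution product on `C_c(G)`. -/
noncomputable def conv (f g : C_c(G, ℂ)) : C_c(G, ℂ) where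
  toFun := convFun f g
  continuous_toFun := continuous_convFun f g
  hasCompactSupport' := hasCompactSupport_convFun f g

theorem hasCompactSupport_comp_inv (f : C_c(G, ℂ)) :
    HasCompactSupport (fun γ => star (f (inv γ))) :=
  (f.hasCompactSupport.comp_homeomorph (invHomeo G)).comp_left (g := star) (star_zero ℂ)

/-- The involution `f^*(γ) = conj (f (γ⁻¹))` on `C_c(G)`. -/
noncomputable def invol (f : C_c(G, ℂ)) : C_c(G, ℂ) where
  toFun γ := star (f (inv γ))
  continuous_toFun := continuous_star.comp (f.continuous.comp IsEtale.continuous_inv)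
  hasCompactSupport' := hasCompactSupport_comp_inv f

end Convolution

/-! ### Operators on `ℓ²` with a banded kernel -/

section Kernel

/-- The Hilbert space `ℓ²(ι)`. -/
abbrev ellTwo (ι : Type*) : Type _ := lp (fun _ : ι => ℂ) 2

variable {ι : Type*}

/-- The entries of `k` are bounded by `C`, and each row and column has at most `N` non-zero ones. -/
structure IsBanded (k : ι → ι → ℂ) (N : ℕ) (C : ℝ) : Prop where
  nonneg : 0 ≤ C
  bound : ∀ a b, ‖k a b‖ ≤ C
  row : ∀ a, ∃ t : Finset ι, t.card ≤ N ∧ ∀ b, k a b ≠ 0 → b ∈ t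
  col : ∀ b, ∃ t : Finset ι, t.card ≤ N ∧ ∀ a, k a b ≠ 0 → a ∈ t

variable {k : ι → ι → ℂ} {N : ℕ} {C : ℝ}

theorem IsBanded.summable (h : IsBanded k N C) (ξ : ι → ℂ) (a : ι) :
    Summable fun b => k a b * ξ b := by
  obtain ⟨t, -, ht⟩ := h.row a
  refine summable_of_ne_finset_zero (s := t) fun b hb => ?_
  have : k a b = 0 := by
    by_contra h'
    exact hb (ht b h')
  simp [this]

theorem IsBanded.sum_le (h : IsBanded k N C) (ξ : ellTwo ι) (F : Finset ι) :
    ∑ a ∈ F, ‖∑' b, k a b * ξ b‖ ^ 2 ≤ (N * C * ‖ξ‖) ^ 2 := by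
  classical
  choose t0 ht0 ht0' using h.row
  choose s hs hs' using h.col
  set t : ι → Finset ι := fun a => (t0 a).filter (fun b => k a b ≠ 0) with ht_def
  have ht : ∀ a, (t a).card ≤ N := fun a => (Finset.card_filter_le _ _).trans (ht0 a)
  have hmem : ∀ a b, b ∈ t a ↔ k a b ≠ 0 := fun a b =>
    ⟨fun hb => (Finset.mem_filter.1 hb).2, fun hb => Finset.mem_filter.2 ⟨ht0' a b hb, hb⟩⟩
  have h1 : ∀ a, ‖∑' b, k a b * ξ b‖ ^ 2 ≤ N * C ^ 2 * ∑ b ∈ t a, ‖ξ b‖ ^ 2 := by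
    intro a
    rw [tsum_eq_sum (s := t a)]
    · have e1 : ‖∑ b ∈ t a, k a b * ξ b‖ ≤ ∑ b ∈ t a, C * ‖ξ b‖ := by
        refine (norm_sum_le _ _).trans (Finset.sum_le_sum fun b _ => ?_)
        rw [norm_mul]
        exact mul_le_mul_of_nonneg_right (h.bound a b) (norm_nonneg _)
      calc ‖∑ b ∈ t a, k a b * ξ b‖ ^ 2 ≤ (∑ b ∈ t a, C * ‖ξ b‖) ^ 2 := by gcongr
        _ ≤ (t a).card * ∑ b ∈ t a, (C * ‖ξ b‖) ^ 2 := sq_sum_le_card_mul_sum_sq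
        _ = (t a).card * (C ^ 2 * ∑ b ∈ t a, ‖ξ b‖ ^ 2) := by
            simp only [mul_pow]; rw [← Finset.mul_sum]
        _ ≤ N * (C ^ 2 * ∑ b ∈ t a, ‖ξ b‖ ^ 2) := by
            have : ((t a).card : ℝ) ≤ N := by exact_mod_cast ht a
            gcongr
        _ = _ := by ring
    · intro b hb
      have : k a b = 0 := by
        by_contra h'
        exact hb ((hmem a b).2 h')
      simp [this]
  have h2 : ∑ a ∈ F, ∑ b ∈ t a, ‖ξ b‖ ^ 2 ≤ N * ‖ξ‖ ^ 2 := by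
    have e1 : ∑ a ∈ F, ∑ b ∈ t a, ‖ξ b‖ ^ 2 =
        ∑ b ∈ F.biUnion t, ∑ a ∈ F.filter (fun a => b ∈ t a), ‖ξ b‖ ^ 2 := by
      refine Finset.sum_comm' fun a b => ?_
      simp only [Finset.mem_biUnion, Finset.mem_filter]
      constructor
      · rintro ⟨ha, hb⟩; exact ⟨⟨ha, hb⟩, a, ha, hb⟩
      · rintro ⟨⟨ha, hb⟩, -⟩; exact ⟨ha, hb⟩
    rw [e1]
    have e2 : ∀ b, ∑ a ∈ F.filter (fun a => b ∈ t a), ‖ξ b‖ ^ 2 ≤ N * ‖ξ b‖ ^ 2 := by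
      intro b
      rw [Finset.sum_const, nsmul_eq_mul]
      have hsub : F.filter (fun a => b ∈ t a) ⊆ s b := fun a ha =>
        hs' b a ((hmem a b).1 (Finset.mem_filter.1 ha).2)
      have : ((F.filter (fun a => b ∈ t a)).card : ℝ) ≤ N := by
        exact_mod_cast (Finset.card_le_card hsub).trans (hs b)
      gcongr
    refine (Finset.sum_le_sum fun b _ => e2 b).trans ?_
    rw [← Finset.mul_sum]
    have e3 := lp.sum_rpow_le_norm_rpow (p := 2) (by norm_num) ξ (F.biUnion t)
    simp only [ENNReal.toReal_ofNat, Real.rpow_ofNat] at e3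
    gcongr
  have hC := h.nonneg
  calc ∑ a ∈ F, ‖∑' b, k a b * ξ b‖ ^ 2 ≤ ∑ a ∈ F, N * C ^ 2 * ∑ b ∈ t a, ‖ξ b‖ ^ 2 :=
        Finset.sum_le_sum fun a _ => h1 a
    _ = N * C ^ 2 * ∑ a ∈ F, ∑ b ∈ t a, ‖ξ b‖ ^ 2 := by rw [Finset.mul_sum]
    _ ≤ N * C ^ 2 * (N * ‖ξ‖ ^ 2) := by gcongr
    _ = _ := by ring

theorem IsBanded.memℓp (h : IsBanded k N C) (ξ : ellTwo ι) :
    Memℓp (fun a => ∑' b, k a b * ξ b) 2 :=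
  memℓp_gen' (C := (N * C * ‖ξ‖) ^ 2) fun F => by
    simpa only [ENNReal.toReal_ofNat, Real.rpow_ofNat] using h.sum_le ξ F

/-- The bounded operator `(T ξ)(a) = ∑ b, k a b * ξ b` on `ℓ²(ι)`. -/
noncomputable def kernelOp (k : ι → ι → ℂ) (h : ∃ N C, IsBanded k N C) :
    ellTwo ι →L[ℂ] ellTwo ι :=
  LinearMap.mkContinuousOfExistsBound
    { toFun := fun ξ => ⟨fun a => ∑' b, k a b * ξ b, h.choose_spec.choose_spec.memℓp ξ⟩
      map_add' := fun ξ η => by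
        ext a
        change ∑' b, k a b * (ξ b + η b) = ∑' b, k a b * ξ b + ∑' b, k a b * η b
        have hs := h.choose_spec.choose_spec
        simp only [mul_add]
        exact (hs.summable ξ a).tsum_add (hs.summable η a)
      map_smul' := fun c ξ => by
        ext a
        change ∑' b, k a b * (c * ξ b) = c * ∑' b, k a b * ξ b
        rw [← tsum_mul_left]
        exact tsum_congr fun b => by ring }
    ⟨h.choose * h.choose_spec.choose, fun ξ => by
      have hs := h.choose_spec.choose_spec
      have hC := hs.nonneg
      refine lp.norm_le_of_forall_sum_le (by norm_num) (by positivity) fun F => ?_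
      simp only [ENNReal.toReal_ofNat, Real.rpow_ofNat]
      exact hs.sum_le ξ F⟩

@[simp] theorem kernelOp_apply (h : ∃ N C, IsBanded k N C) (ξ : ellTwo ι) (a : ι) :
    kernelOp k h ξ a = ∑' b, k a b * ξ b := rfl

theorem norm_kernelOp_le (h : ∃ N C, IsBanded k N C) (hk : IsBanded k N C) :
    ‖kernelOp k h‖ ≤ N * C := by
  have hC := hk.nonneg
  refine ContinuousLinearMap.opNorm_le_bound _ (by positivity) fun ξ => ?_
  refine lp.norm_le_of_forall_sum_le (by norm_num) (by positivity) fun F => ?_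
  simp only [ENNReal.toReal_ofNat, Real.rpow_ofNat]
  exact hk.sum_le ξ F

theorem kernelOp_single [DecidableEq ι] (h : ∃ N C, IsBanded k N C) (a b : ι) :
    kernelOp k h (lp.single 2 b 1) a = k a b := by
  rw [kernelOp_apply, tsum_eq_single b]
  · simp
  · intro c hc
    simp [lp.single_apply, Pi.single_eq_of_ne hc]

theorem ellTwo_ext [DecidableEq ι] {S T : ellTwo ι →L[ℂ] ellTwo ι}
    (h : ∀ a b, S (lp.single 2 b 1) a = T (lp.single 2 b 1) a) : S = T := by
  refine lp.ext_continuousLinearMap (by norm_num) fun b => ?_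
  refine ContinuousLinearMap.ext_ring ?_
  ext a
  exact h a b

end Kernel

/-! ### The regular representations -/

section Regular

variable {G : Type*} [TopologicalSpace G] [ArrowGroupoid G]

/-- The fibre `G_x = d⁻¹(x)`. -/
abbrev Fibre (x : units (G := G)) := {α : G // d α = x.1}

/-- The kernel of `λ_x(f)`. -/
def regKernel (f : G → ℂ) (x : units (G := G)) (γ α : Fibre x) : ℂ := f (mul γ.1 (inv α.1))

variable [IsEtale G]

theorem exists_isBanded (f : C_c(G, ℂ)) : ∃ N C, ∀ x, IsBanded (regKernel (G := G) f x) N C := by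
  classical
  obtain ⟨N₁, h₁⟩ := exists_card_le (isLocalHomeomorph_r G) f.hasCompactSupport
  obtain ⟨N₂, h₂⟩ := exists_card_le (IsEtale.isLocalHomeomorph_d (G := G)) f.hasCompactSupport
  obtain ⟨C, hC⟩ := f.hasCompactSupport.exists_bound_of_continuous f.continuous
  refine ⟨max N₁ N₂, max C 0, fun x => ⟨le_max_right _ _, fun γ α => (hC _).trans (le_max_left _ _),
    fun γ => ?_, fun α => ?_⟩⟩
  · obtain ⟨t, ht, ht'⟩ := h₁ ⟨r γ.1, r_mem _⟩
    have hinj : Function.Injective (fun α : Fibre x => mul γ.1 (inv α.1)) := by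
      intro α β h
      exact (fibreEquiv (x := x.1) γ.2 rfl).injective (a₁ := α) (a₂ := β) (Subtype.ext h)
    refine ⟨t.preimage (fun α : Fibre x => mul γ.1 (inv α.1)) hinj.injOn, ?_, fun α hα => ?_⟩
    · exact (Finset.card_le_card_of_injOn (fun α : Fibre x => mul γ.1 (inv α.1))
        (fun δ hδ => by rwa [Finset.mem_coe, Finset.mem_preimage] at hδ) hinj.injOn).trans
        (ht.trans (le_max_left _ _))
    · refine Finset.mem_preimage.2 (ht' _ (subset_tsupport _ hα) (Subtype.ext ?_))
      exact r_mul_inv (γ.2.trans α.2.symm)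
  · obtain ⟨t, ht, ht'⟩ := h₂ ⟨r α.1, r_mem _⟩
    have hinj : Function.Injective (fun γ : Fibre x => mul γ.1 (inv α.1)) := by
      intro β γ h
      have := congrArg (fun δ => mul δ α.1) h
      simp only at this
      rw [inv_mul_cancel_right (β.2.trans α.2.symm),
        inv_mul_cancel_right (γ.2.trans α.2.symm)] at this
      exact Subtype.ext this
    refine ⟨t.preimage (fun γ : Fibre x => mul γ.1 (inv α.1)) hinj.injOn, ?_, fun γ hγ => ?_⟩
    · exact (Finset.card_le_card_of_injOn (fun γ : Fibre x => mul γ.1 (inv α.1))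
        (fun δ hδ => by rwa [Finset.mem_coe, Finset.mem_preimage] at hδ) hinj.injOn).trans
        (ht.trans (le_max_right _ _))
    · refine Finset.mem_preimage.2 (ht' _ (subset_tsupport _ hγ) (Subtype.ext ?_))
      exact d_mul_inv (γ.2.trans α.2.symm)

theorem exists_isBanded' (f : C_c(G, ℂ)) (x : units (G := G)) :
    ∃ N C, IsBanded (regKernel (G := G) f x) N C :=
  let ⟨N, C, h⟩ := exists_isBanded f
  ⟨N, C, h x⟩

/-- The left regular representation `λ_x : C_c(G) → B(ℓ²(G_x))`,
`(λ_x(f) ξ)(γ) = ∑_{α ∈ G_x} f(γ α⁻¹) ξ(α)`. On basis vectors, this is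
`λ_x(f) δ_α = ∑_{β ∈ G_{r(α)}} f(β) δ_{βα}`. -/
noncomputable def regRep (x : units (G := G)) (f : C_c(G, ℂ)) :
    ellTwo (Fibre x) →L[ℂ] ellTwo (Fibre x) :=
  kernelOp (regKernel f x) (exists_isBanded' f x)

theorem regRep_single (x : units (G := G)) [DecidableEq (Fibre x)] (f : C_c(G, ℂ))
    (α γ : Fibre x) : regRep x f (lp.single 2 α 1) γ = f (mul γ.1 (inv α.1)) :=
  kernelOp_single _ _ _

theorem memℓp_regRep (f : C_c(G, ℂ)) :
    Memℓp (fun x : units (G := G) => regRep x f) ∞ := by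
  obtain ⟨N, C, h⟩ := exists_isBanded f
  refine memℓp_infty ⟨N * C, ?_⟩
  rintro _ ⟨x, rfl⟩
  exact norm_kernelOp_le _ (h x)

variable (G) in
/-- The C*-algebra of bounded families `(T_x)` in `∏_{x ∈ G⁽⁰⁾} B(ℓ²(G_x))`, with the norm
`sup_x ‖T_x‖`. -/
def FibreOps : Type _ :=
  lp (fun x : units (G := G) => ellTwo (Fibre x) →L[ℂ] ellTwo (Fibre x)) ∞

noncomputable instance : NonUnitalCStarAlgebra (FibreOps G) :=
  inferInstanceAs (NonUnitalCStarAlgebra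
    (lp (fun x : units (G := G) => ellTwo (Fibre x) →L[ℂ] ellTwo (Fibre x)) ∞))

/-- The component at `x` of a bounded family. -/
def FibreOps.at (T : FibreOps G) (x : units (G := G)) : ellTwo (Fibre x) →L[ℂ] ellTwo (Fibre x) :=
  T.1 x

theorem FibreOps.ext [∀ x : units (G := G), DecidableEq (Fibre x)] {S T : FibreOps G}
    (h : ∀ (x : units (G := G)) (γ α : Fibre x),
      S.at x (lp.single 2 α 1) γ = T.at x (lp.single 2 α 1) γ) : S = T := by
  refine Subtype.ext (funext fun x => ?_)
  exact ellTwo_ext (h x)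

/-- The family `(λ_x(f))_x` of all the left regular representations of `f`. -/
noncomputable def regFun (f : C_c(G, ℂ)) : FibreOps G :=
  ⟨fun x => regRep x f, memℓp_regRep f⟩

/-- The map `f ↦ (λ_x(f))_x`. -/
noncomputable def reg : C_c(G, ℂ) →ₗ[ℂ] FibreOps G where
  toFun := regFun
  map_add' f g := by
    classical
    refine FibreOps.ext fun x a b => ?_
    change regRep x (f + g) (lp.single 2 b 1) a =
      regRep x f (lp.single 2 b 1) a + regRep x g (lp.single 2 b 1) a
    simp only [regRep_single]
    rfl
  map_smul' c f := by
    classical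
    refine FibreOps.ext fun x a b => ?_
    change regRep x (c • f) (lp.single 2 b 1) a = c • regRep x f (lp.single 2 b 1) a
    simp only [regRep_single]
    rfl

/-- The reduced norm on `C_c(G)`. -/
noncomputable def reducedNorm (f : C_c(G, ℂ)) : ℝ := ⨆ x : units (G := G), ‖regRep x f‖

theorem norm_reg (f : C_c(G, ℂ)) : ‖reg f‖ = reducedNorm f := rfl

theorem reg_injective : Function.Injective (reg : C_c(G, ℂ) → FibreOps G) := by
  classical
  intro f g h
  ext γ
  have h1 : regRep ⟨d γ, d_mem γ⟩ f = regRep ⟨d γ, d_mem γ⟩ g :=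
    congrArg (fun T : FibreOps G => T.at ⟨d γ, d_mem γ⟩) h
  have h2 := congrArg (fun T => (T (lp.single 2 (⟨d γ, d_unit _ (d_mem γ)⟩ : Fibre _) 1) :
    ∀ _, ℂ) (⟨γ, rfl⟩ : Fibre _)) h1
  simp only [regRep_single, inv_unit (d_mem γ), mul_d] at h2
  exact h2

variable [T2Space G]

theorem reg_conv (f g : C_c(G, ℂ)) : reg (conv f g) = reg f * reg g := by
  classical
  refine FibreOps.ext fun x γ α => ?_
  change regRep x (conv f g) (lp.single 2 α 1) γ = regRep x f (regRep x g (lp.single 2 α 1)) γ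
  have h : d γ.1 = d α.1 := γ.2.trans α.2.symm
  rw [regRep_single]
  change convFun f g _ = ∑' β : Fibre x, f (mul γ.1 (inv β.1)) * _
  simp only [regRep_single]
  rw [convFun_eq, ← (fibreEquiv γ.2 (r_mul_inv h).symm).tsum_eq]
  refine tsum_congr fun β => ?_
  have hβ : d γ.1 = d β.1 := γ.2.trans β.2.symm
  change f (mul γ.1 (inv β.1)) * g (mul (inv (mul γ.1 (inv β.1))) (mul γ.1 (inv α.1))) = _
  rw [mul_inv_rev hβ, ← assoc _ _ _ ((d_mul_inv hβ.symm).trans rfl) (h.trans (r_inv _).symm),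
    inv_mul_cancel_right hβ.symm]

theorem reg_invol (f : C_c(G, ℂ)) : reg (invol f) = star (reg f) := by
  classical
  refine FibreOps.ext fun x γ α => ?_
  change regRep x (invol f) (lp.single 2 α 1) γ =
    ContinuousLinearMap.adjoint (regRep x f) (lp.single 2 α 1) γ
  have h : d γ.1 = d α.1 := γ.2.trans α.2.symm
  have e : ∀ ξ : ellTwo (Fibre x), ξ γ = inner ℂ (lp.single 2 γ (1 : ℂ)) ξ := fun ξ => by
    rw [lp.inner_single_left]; simp
  rw [e (ContinuousLinearMap.adjoint _ _), ContinuousLinearMap.adjoint_inner_right,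
    lp.inner_single_right, regRep_single, regRep_single]
  change star (f (inv _)) = _
  rw [mul_inv_rev h]
  simp

variable (G) in
/-- The image of `C_c(G)` under the left regular representations. -/
noncomputable def regImage : NonUnitalStarSubalgebra ℂ (FibreOps G) where
  carrier := Set.range (reg : C_c(G, ℂ) → FibreOps G)
  add_mem' := by
    rintro _ _ ⟨f, rfl⟩ ⟨g, rfl⟩
    exact ⟨f + g, map_add _ _ _⟩
  zero_mem' := ⟨0, map_zero _⟩
  mul_mem' := by
    rintro _ _ ⟨f, rfl⟩ ⟨g, rfl⟩
    exact ⟨conv f g, reg_conv f g⟩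
  smul_mem' := by
    rintro c _ ⟨f, rfl⟩
    exact ⟨c • f, map_smul _ _ _⟩
  star_mem' := by
    rintro _ ⟨f, rfl⟩
    exact ⟨invol f, reg_invol f⟩

variable (G) in
/-- The reduced groupoid C*-algebra `C*_r(G)`: the completion of `C_c(G)` with respect to the
reduced norm, realised as the closure of the isometric copy `reg '' C_c(G)` of `C_c(G)` in the
complete space of bounded families of operators. -/
noncomputable def reducedSubalgebra : NonUnitalStarSubalgebra ℂ (FibreOps G) :=
  (regImage G).topologicalClosure

variable (G) in
/-- The reduced groupoid C*-algebra `C*_r(G)` as a C*-algebra on its own. -/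
def ReducedCStar : Type _ := reducedSubalgebra G

noncomputable instance : NonUnitalCStarAlgebra (ReducedCStar G) :=
  NonUnitalStarSubalgebra.nonUnitalCStarAlgebra (reducedSubalgebra G)
    (h_closed := (regImage G).isClosed_topologicalClosure)

/-- The inclusion `C_c(G) → C*_r(G)`. -/
noncomputable def toCStar : C_c(G, ℂ) →ₗ[ℂ] ReducedCStar G where
  toFun f := ⟨reg f, (regImage G).le_topologicalClosure ⟨f, rfl⟩⟩
  map_add' f g := Subtype.ext (map_add reg f g)
  map_smul' c f := Subtype.ext (map_smul reg c f)

theorem norm_toCStar (f : C_c(G, ℂ)) : ‖toCStar f‖ = reducedNorm f := rfl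

theorem denseRange_toCStar : DenseRange (toCStar : C_c(G, ℂ) → ReducedCStar G) := by
  have h : Dense ((↑) ⁻¹' (Set.range (reg : C_c(G, ℂ) → FibreOps G)) :
      Set (closure (Set.range (reg : C_c(G, ℂ) → FibreOps G)))) :=
    Subtype.dense_iff.2 fun x hx => by
      rwa [Subtype.image_preimage_coe, Set.inter_eq_right.2 subset_closure]
  refine h.mono ?_
  rintro ⟨x, hx⟩ ⟨f, hf⟩
  exact ⟨f, Subtype.ext hf⟩

theorem toCStar_conv (f g : C_c(G, ℂ)) : toCStar (conv f g) = toCStar f * toCStar g :=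
  Subtype.ext (reg_conv f g)

theorem toCStar_invol (f : C_c(G, ℂ)) : toCStar (invol f) = star (toCStar f) :=
  Subtype.ext (reg_invol f)

theorem conv_unit {f g : C_c(G, ℂ)} (hf : ∀ α ∉ units, f α = 0) (hg : ∀ α ∉ units, g α = 0) :
    ∀ α ∉ units, conv f g α = 0 := by
  intro γ hγ
  by_contra h
  obtain ⟨α, β, h1, h2, h3, h4⟩ := exists_of_convFun_ne h
  refine hγ (h2 ▸ mul_mem_units (not_imp_comm.1 (hf α) h3) (not_imp_comm.1 (hg β) h4) h1)

variable (G) in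
/-- `C_c(G⁽⁰⁾)` (the functions in `C_c(G)` that vanish off the clopen set `G⁽⁰⁾`) as a
*-subalgebra of `C*_r(G)`. -/
noncomputable def ccUnits : NonUnitalStarSubalgebra ℂ (ReducedCStar G) where
  carrier := toCStar '' {f : C_c(G, ℂ) | ∀ α ∉ units, f α = 0}
  add_mem' := by
    rintro _ _ ⟨f, hf, rfl⟩ ⟨g, hg, rfl⟩
    exact ⟨f + g, fun α hα => by simp [hf α hα, hg α hα], map_add _ _ _⟩
  zero_mem' := ⟨0, fun _ _ => rfl, map_zero _⟩
  mul_mem' := by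
    rintro _ _ ⟨f, hf, rfl⟩ ⟨g, hg, rfl⟩
    exact ⟨conv f g, conv_unit hf hg, toCStar_conv f g⟩
  smul_mem' := by
    rintro c _ ⟨f, hf, rfl⟩
    exact ⟨c • f, fun α hα => by simp [hf α hα], map_smul _ _ _⟩
  star_mem' := by
    rintro _ ⟨f, hf, rfl⟩
    refine ⟨invol f, fun α hα => ?_, toCStar_invol f⟩
    change star (f (inv α)) = 0
    rw [hf, star_zero]
    intro h
    refine hα ?_
    rw [← inv_inv' α, inv_unit h]
    exact h

variable (G) in
/-- `C_0(G⁽⁰⁾)` as a C*-subalgebra of `C*_r(G)`: the closure of `C_c(G⁽⁰⁾)`. -/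
noncomputable def czeroUnits : NonUnitalStarSubalgebra ℂ (ReducedCStar G) :=
  (ccUnits G).topologicalClosure

end Regular

/-! ### Automorphisms and cocycles -/

/-- `Aut_D(A)`: the *-automorphisms of `A` which preserve `D` globally. -/
def starAutPreserving {A : Type*} [NonUnitalRing A] [StarRing A] [Module ℂ A]
    (D : NonUnitalStarSubalgebra ℂ A) : Subgroup (A ≃⋆ₐ[ℂ] A) where
  carrier := {φ | φ '' (D : Set A) = D}
  one_mem' := Set.image_id _
  mul_mem' := by
    intro φ ψ hφ hψ
    change (fun a => φ (ψ a)) '' (D : Set A) = D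
    rw [← Set.image_image, hψ, hφ]
  inv_mem' := by
    intro φ hφ
    change φ.symm '' (D : Set A) = D
    nth_rewrite 1 [← (show φ '' (D : Set A) = D from hφ)]
    rw [Set.image_image]
    simp

section Aut

variable (G : Type*) [TopologicalSpace G] [ArrowGroupoid G]

/-- A map of groupoids is a homomorphism if it preserves composable pairs and their products. -/
def IsHom {H : Type*} [ArrowGroupoid H] (Φ : G → H) : Prop :=
  ∀ α β, d α = r β → d (Φ α) = r (Φ β) ∧ Φ (mul α β) = mul (Φ α) (Φ β)

variable {G} in
theorem IsHom.map_d {Φ : G → G} (h : IsHom G Φ) (α : G) : d (Φ α) = Φ (d α) := by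
  have h1 : d (d α) = r (d α) := by rw [d_unit _ (d_mem α), r_unit _ (d_mem α)]
  have h2 := h (d α) (d α) h1
  have h3 : Φ (d α) ∈ units := mem_units_of_mul_self h2.1 (by
    rw [← h2.2]
    have := mul_d (d α)
    rw [d_unit _ (d_mem α)] at this
    rw [this])
  have h4 := (h α (d α) (by rw [r_unit _ (d_mem α)])).1
  rw [h4, r_unit _ h3]

variable {G} in
theorem IsHom.map_r {Φ : G → G} (h : IsHom G Φ) (α : G) : r (Φ α) = Φ (r α) := by
  have h1 := (h (r α) α (by rw [d_unit _ (r_mem α)])).1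
  rw [← h1, h.map_d, d_unit _ (r_mem α)]

/-- `Aut(G)`: the groupoid automorphisms of `G` that are homeomorphisms. -/
def autGroup : Subgroup (G ≃ₜ G) where
  carrier := {Φ | IsHom G Φ}
  one_mem' := fun _ _ h => ⟨h, rfl⟩
  mul_mem' := by
    intro Φ Ψ hΦ hΨ α β h
    have h1 := hΨ α β h
    have h2 := hΦ _ _ h1.1
    exact ⟨h2.1, (congrArg Φ h1.2).trans h2.2⟩
  inv_mem' := by
    intro Φ hΦ α β h
    have h1 : d (Φ.symm α) = r (Φ.symm β) := by
      apply Φ.injective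
      rw [← IsHom.map_d hΦ, ← IsHom.map_r hΦ]
      simpa using h
    refine ⟨h1, ?_⟩
    apply Φ.injective
    change Φ (Φ.symm (mul α β)) = Φ (mul (Φ.symm α) (Φ.symm β))
    rw [(hΦ _ _ h1).2]
    simp

/-- `Z(G, 𝕋)`: the continuous homomorphisms `G → 𝕋`, with the pointwise product. -/
noncomputable def cocycles : Subgroup C(G, Circle) where
  carrier := {c | ∀ α β, d α = r β → c (mul α β) = c α * c β}
  one_mem' := fun _ _ _ => (mul_one _).symm
  mul_mem' := by
    intro b c hb hc α β h
    change b (mul α β) * c (mul α β) = b α * c α * (b β * c β)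
    rw [hb α β h, hc α β h, mul_mul_mul_comm]
  inv_mem' := by
    intro c hc α β h
    change (c (mul α β))⁻¹ = (c α)⁻¹ * (c β)⁻¹
    rw [hc α β h, _root_.mul_inv]

variable {G}

/-- The action `(Φ.c)(α) = c(Φ⁻¹(α))` of `Aut(G)` on `Z(G, 𝕋)`. -/
noncomputable def actCocycle (Φ : autGroup G) (c : cocycles G) : cocycles G :=
  ⟨(c : C(G, Circle)).comp ⟨(Φ : G ≃ₜ G).symm, (Φ : G ≃ₜ G).symm.continuous⟩, fun α β h => by
    have h1 := (Φ⁻¹).2 α β h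
    change (c : C(G, Circle)) ((Φ : G ≃ₜ G).symm (mul α β)) = _
    exact (congrArg (c : C(G, Circle)) h1.2).trans (c.2 _ _ h1.1)⟩

variable (G) in
/-- The semidirect product `Aut(G) ⋉ Z(G, 𝕋)`. -/
@[ext] structure AutSemidirect where
  aut : autGroup G
  coc : cocycles G

namespace AutSemidirect

noncomputable instance : Mul (AutSemidirect G) :=
  ⟨fun a b => ⟨a.aut * b.aut, actCocycle b.aut⁻¹ a.coc * b.coc⟩⟩

noncomputable instance : One (AutSemidirect G) := ⟨⟨1, 1⟩⟩

noncomputable instance : Inv (AutSemidirect G) := ⟨fun a => ⟨a.aut⁻¹, actCocycle a.aut a.coc⁻¹⟩⟩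

theorem mul_def (a b : AutSemidirect G) :
    a * b = ⟨a.aut * b.aut, actCocycle b.aut⁻¹ a.coc * b.coc⟩ := rfl

noncomputable instance : Group (AutSemidirect G) :=
  Group.ofLeftAxioms
    (fun a b c => AutSemidirect.ext (mul_assoc _ _ _) (Subtype.ext (ContinuousMap.ext fun α =>
      mul_assoc (a.coc.1 (b.aut.1 (c.aut.1 α))) (b.coc.1 (c.aut.1 α)) (c.coc.1 α))))
    (fun a => AutSemidirect.ext (one_mul _) (Subtype.ext (ContinuousMap.ext fun α =>
      one_mul (a.coc.1 α))))
    (fun a => AutSemidirect.ext (inv_mul_cancel _) (Subtype.ext (ContinuousMap.ext fun α => by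
      change (a.coc.1 (a.aut.1.symm (a.aut.1 α)))⁻¹ * a.coc.1 α = 1
      rw [Homeomorph.symm_apply_apply, inv_mul_cancel])))

end AutSemidirect

/-- The function `φ_{Φ,c}(f)(α) = c(Φ⁻¹(α)) f(Φ⁻¹(α))` in `C_c(G)`. -/
noncomputable def twist (Φ : autGroup G) (c : cocycles G) (f : C_c(G, ℂ)) : C_c(G, ℂ) where
  toFun α := ((c : C(G, Circle)) ((Φ : G ≃ₜ G).symm α) : ℂ) * f ((Φ : G ≃ₜ G).symm α)
  continuous_toFun := by fun_prop
  hasCompactSupport' := (f.hasCompactSupport.comp_homeomorph (Φ : G ≃ₜ G).symm).mul_left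

end Aut

end ArrowGroupoid

/-! An element `a` of `C*_r(G)` is treated as a continuous function on `G` through its matrix
coefficients `coeff a`. These determine `a` (`coeff_ext`) and are uniform limits of functions in
`C_c(G)`. Multiplying by a factor whose support is a bisection involves only one term of the
convolution (`coeff_mul_of_unique`), so no convergence question arises. The subalgebra `C_0(G⁽⁰⁾)`
consists exactly of the elements whose coefficients vanish off the units
(`mem_czeroUnits_of_coeff`).

For surjectivity, let `φ` preserve `C_0(G⁽⁰⁾)`. Gelfand duality, proved by hand in
`exists_eq_coeff_of_character`, gives an injective map `k` of the unit space dual to `φ`. If `a` is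
supported on a bisection, then every arrow in the support of `φ a` lies over the `k`-preimage of the
source and range of an arrow in the support of `a` (`exists_of_coeff_apply_ne_zero`). This controls
sources and ranges but not isotropy. Here effectiveness enters: two arrows `α`, `β` in the support
of `φ a` with a common source produce an open set of isotropy around `αβ⁻¹`, hence a unit, so `α =
β`. Thus `φ` maps elements supported on bisections to such elements
(`isBisection_support_coeff_apply`).

For two such elements `a`, `b`, a localised product `a* f b` lies in `C_0(G⁽⁰⁾)`, where `φ` is
already known. This pins down both the arrow at which `φ a` and `φ b` are non-zero and the number
`conj (φ a) · φ b` there (`coeff_apply_pairing`). Hence `φ` has the form `a ↦ w · (a ∘ θ)` with `w`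
unimodular (`exists_weighted_comp`). Bump functions show that `θ` and `w` are continuous and
multiplicative, and the same analysis of `φ⁻¹` inverts `θ`. Then `Φ = θ⁻¹` and `c = w ∘ θ⁻¹`.

In the other direction, twisting by `(Φ, c)` turns `λ_x` into a representation unitarily equivalent
to `λ_y`, `y = Φ⁻¹(x)`. It is therefore isometric for the reduced norm and extends to `C*_r(G)`. -/

namespace ArrowGroupoid

/-! ### Matrix coefficients of elements of `C*_r(G)` -/

section Coefficients

variable {G : Type*} [TopologicalSpace G] [ArrowGroupoid G] [IsEtale G] [T2Space G]

/-- The extension of the regular representation at `x` to `C*_r(G)`. -/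
noncomputable def fibreRep (x : units (G := G)) :
    ReducedCStar G →L[ℂ] (ellTwo (Fibre x) →L[ℂ] ellTwo (Fibre x)) :=
  LinearMap.mkContinuous
    { toFun := fun a => FibreOps.at a.1 x
      map_add' := fun _ _ => rfl
      map_smul' := fun _ _ => rfl } 1 fun a => by
    rw [one_mul]
    exact lp.norm_apply_le_norm (by simp) (show lp _ ∞ from a.1) x

theorem norm_fibreRep_apply_le (x : units (G := G)) (a : ReducedCStar G) :
    ‖fibreRep x a‖ ≤ ‖a‖ :=
  lp.norm_apply_le_norm (by simp) (show lp _ ∞ from a.1) x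

theorem fibreRep_toCStar (x : units (G := G)) (f : C_c(G, ℂ)) :
    fibreRep x (toCStar f) = regRep x f := rfl

theorem fibreRep_mul_apply (x : units (G := G)) (a b : ReducedCStar G) (ξ : ellTwo (Fibre x)) :
    fibreRep x (a * b) ξ = fibreRep x a (fibreRep x b ξ) := rfl

theorem fibreRep_star (x : units (G := G)) (a : ReducedCStar G) :
    fibreRep x (star a) = ContinuousLinearMap.adjoint (fibreRep x a) := rfl

/-- The unit in the fibre over `x`. -/
def Fibre.base (x : units (G := G)) : Fibre x := ⟨x.1, d_unit _ x.2⟩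

open Classical in
/-- The value at `γ` of the continuous function on `G` which corresponds to an element of
`C*_r(G)`. -/
noncomputable def coeff (a : ReducedCStar G) (γ : G) : ℂ :=
  fibreRep ⟨d γ, d_mem γ⟩ a (lp.single 2 (Fibre.base _) 1) ⟨γ, rfl⟩

theorem norm_ellTwo_apply_le {ι : Type*} (ξ : ellTwo ι) (i : ι) : ‖ξ i‖ ≤ ‖ξ‖ :=
  lp.norm_apply_le_norm (by simp) ξ i

theorem norm_coeff_le (a : ReducedCStar G) (γ : G) : ‖coeff a γ‖ ≤ ‖a‖ := by
  classical
  refine (norm_ellTwo_apply_le _ _).trans ?_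
  refine (ContinuousLinearMap.le_opNorm _ _).trans ?_
  rw [lp.norm_single (by norm_num)]
  simpa using norm_fibreRep_apply_le _ a

theorem coeff_add (a b : ReducedCStar G) (γ : G) : coeff (a + b) γ = coeff a γ + coeff b γ := by
  classical
  simp only [coeff, map_add]
  rfl

theorem coeff_smul (z : ℂ) (a : ReducedCStar G) (γ : G) : coeff (z • a) γ = z * coeff a γ := by
  classical
  simp only [coeff, map_smul]
  rfl

/-- `coeff` at `γ` as a continuous linear functional. -/
noncomputable def coeffL (γ : G) : ReducedCStar G →L[ℂ] ℂ :=
  LinearMap.mkContinuous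
    { toFun := fun a => coeff a γ
      map_add' := fun a b => coeff_add a b γ
      map_smul' := fun z a => coeff_smul z a γ } 1 fun a => by
    rw [one_mul]; exact norm_coeff_le a γ

theorem coeffL_apply (a : ReducedCStar G) (γ : G) : coeffL γ a = coeff a γ := rfl

theorem coeff_sum {ι : Type*} (s : Finset ι) (a : ι → ReducedCStar G) (γ : G) :
    coeff (∑ i ∈ s, a i) γ = ∑ i ∈ s, coeff (a i) γ :=
  map_sum (coeffL γ) a s

theorem coeff_sub (a b : ReducedCStar G) (γ : G) : coeff (a - b) γ = coeff a γ - coeff b γ :=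
  map_sub (coeffL γ) a b

theorem coeff_toCStar (f : C_c(G, ℂ)) (γ : G) : coeff (toCStar f) γ = f γ := by
  classical
  rw [coeff, fibreRep_toCStar, regRep_single]
  change f (mul γ (inv (d γ))) = f γ
  rw [inv_unit (d_mem γ), mul_d]

/-- Two continuous maps on `C*_r(G)` agree if they do on `C_c(G)`. -/
theorem eq_of_eqOn_toCStar {Y : Type*} [TopologicalSpace Y] [T2Space Y] {p q : ReducedCStar G → Y}
    (hp : Continuous p) (hq : Continuous q)
    (h : ∀ f : C_c(G, ℂ), p (toCStar f) = q (toCStar f)) (a : ReducedCStar G) : p a = q a :=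
  congrFun (denseRange_toCStar.equalizer hp hq (funext h)) a

theorem fibreRep_single (x : units (G := G)) [DecidableEq (Fibre x)] (a : ReducedCStar G)
    (γ α : Fibre x) :
    fibreRep x a (lp.single 2 α 1) γ = coeff a (mul γ.1 (inv α.1)) := by
  refine eq_of_eqOn_toCStar (p := fun a => fibreRep x a (lp.single 2 α 1) γ)
    (q := fun a => coeff a (mul γ.1 (inv α.1))) ?_ (coeffL _).continuous (fun f => ?_) a
  · have h : Continuous fun ξ : ellTwo (Fibre x) => ξ γ :=
      (lp.evalCLM ℂ (fun _ : Fibre x => ℂ) 2 γ).continuous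
    exact h.comp ((fibreRep x).continuous.clm_apply continuous_const)
  · rw [coeff_toCStar, fibreRep_toCStar, regRep_single]

theorem coeff_ext {a b : ReducedCStar G} (h : ∀ γ, coeff a γ = coeff b γ) : a = b := by
  classical
  refine Subtype.ext (FibreOps.ext fun x γ α => ?_)
  change fibreRep x a (lp.single 2 α 1) γ = fibreRep x b (lp.single 2 α 1) γ
  rw [fibreRep_single, fibreRep_single, h]

theorem coeff_star (a : ReducedCStar G) (γ : G) : coeff (star a) γ = star (coeff a (inv γ)) := by
  refine eq_of_eqOn_toCStar (p := fun a => coeff (star a) γ)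
    (q := fun a => star (coeff a (inv γ))) ((coeffL γ).continuous.comp continuous_star)
    (continuous_star.comp (coeffL _).continuous) (fun f => ?_) a
  simp only [← toCStar_invol, coeff_toCStar]
  rfl

/-- Each coefficient is bounded by the norm, so norm approximation by `C_c(G)` is uniform
approximation of coefficients. -/
theorem continuous_coeff (a : ReducedCStar G) : Continuous (coeff a) := by
  refine continuous_of_uniform_approx_of_continuous fun u hu => ?_
  obtain ⟨ε, hε, hεu⟩ := Metric.mem_uniformity_dist.1 hu
  obtain ⟨f, hf⟩ := denseRange_toCStar.exists_dist_lt a hε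
  refine ⟨f, f.continuous, fun γ => hεu ?_⟩
  rw [← coeff_toCStar, dist_eq_norm, ← coeff_sub]
  refine (norm_coeff_le _ _).trans_lt ?_
  rwa [← dist_eq_norm]

/-- If `β` is the only arrow of its fibre where `b` can be non-zero, then `b` sends the basis vector
at the unit `d γ` to a multiple of the basis vector at `β`, and the convolution sum has a single
term. -/
theorem coeff_mul_of_unique {a b : ReducedCStar G} {γ β : G} (hd : d γ = d β)
    (h : ∀ δ, d δ = d β → coeff b δ ≠ 0 → δ = β) :
    coeff (a * b) γ = coeff a (mul γ (inv β)) * coeff b β := by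
  classical
  have h1 : fibreRep ⟨d γ, d_mem γ⟩ b (lp.single 2 (Fibre.base _) 1) =
      coeff b β • lp.single 2 (⟨β, hd.symm⟩ : Fibre ⟨d γ, d_mem γ⟩) (1 : ℂ) := by
    ext δ
    rw [fibreRep_single]
    change coeff b (mul δ.1 (inv (d γ))) = coeff b β *
      (lp.single 2 (⟨β, hd.symm⟩ : Fibre ⟨d γ, d_mem γ⟩) (1 : ℂ) :
        ellTwo (Fibre ⟨d γ, d_mem γ⟩)) δ
    have hδ : d δ.1 = d γ := δ.2
    have hm : ∀ ε : G, d ε = d γ → mul ε (inv (d γ)) = ε := fun ε hε => by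
      rw [inv_unit (d_mem γ), ← hε, mul_d]
    rw [hm _ hδ]
    by_cases e : δ = ⟨β, hd.symm⟩
    · subst e; simp
    · rw [lp.single_apply, Pi.single_eq_of_ne e, mul_zero]
      by_contra hne
      exact e (Subtype.ext (h δ.1 (hδ.trans hd) hne))
  rw [coeff, fibreRep_mul_apply, h1, map_smul]
  change coeff b β * _ = _
  rw [fibreRep_single, mul_comm]

/-- The coefficient of `a* a` at the unit `x = d γ` is the squared norm of the vector `a δ_x`, one
of whose entries is `coeff a γ`. No condition on the support of `a` is needed. -/
theorem coeff_star_mul_self_ne_zero {a : ReducedCStar G} {γ : G} (h : coeff a γ ≠ 0) :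
    coeff (star a * a) (d γ) ≠ 0 := by
  classical
  intro h0
  apply h
  have e : d (d γ) = d γ := d_unit _ (d_mem γ)
  have h1 : ∀ ξ : ellTwo (Fibre (⟨d γ, d_mem γ⟩ : units (G := G))),
      ξ (Fibre.base _) = inner ℂ (lp.single 2 (Fibre.base _) (1 : ℂ)) ξ := fun ξ => by
    rw [lp.inner_single_left]; simp
  have h2 := fibreRep_single ⟨d γ, d_mem γ⟩ (star a * a) (Fibre.base _) (Fibre.base _)
  rw [show mul (Fibre.base (⟨d γ, d_mem γ⟩ : units (G := G))).1
    (inv (Fibre.base (⟨d γ, d_mem γ⟩ : units (G := G))).1) = d γ by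
      rw [ArrowGroupoid.mul_inv]; exact r_unit _ (d_mem γ), h0, h1, fibreRep_mul_apply,
      fibreRep_star, ContinuousLinearMap.adjoint_inner_right,
      inner_self_eq_zero] at h2
  rw [coeff, h2]
  rfl

/-! ### The subalgebra `C_0(G⁽⁰⁾)` -/

theorem isClosed_units : IsClosed (units : Set G) := by
  have : (units : Set G) = {α | d α = α} :=
    Set.ext fun α => ⟨fun h => d_unit _ h, fun h => by rw [← show d α = α from h]; exact d_mem α⟩
  rw [this]
  exact isClosed_eq continuous_d continuous_id

theorem toCStar_mem_czeroUnits {f : C_c(G, ℂ)} (hf : ∀ α ∉ units, f α = 0) :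
    toCStar f ∈ czeroUnits G :=
  (ccUnits G).le_topologicalClosure ⟨f, hf, rfl⟩

theorem coeff_eq_zero_of_mem {a : ReducedCStar G} (ha : a ∈ czeroUnits G) {γ : G}
    (hγ : γ ∉ units) : coeff a γ = 0 := by
  have hc : IsClosed {a : ReducedCStar G | coeff a γ = 0} :=
    isClosed_eq (coeffL γ).continuous continuous_const
  have : (ccUnits G : Set (ReducedCStar G)) ⊆ {a | coeff a γ = 0} := by
    rintro _ ⟨f, hf, rfl⟩
    exact (coeff_toCStar f γ).trans (hf γ hγ)
  exact closure_minimal this hc ha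

theorem mem_units_of_coeff_ne_zero {a : ReducedCStar G} (ha : a ∈ czeroUnits G) {γ : G}
    (hγ : coeff a γ ≠ 0) : γ ∈ units :=
  not_imp_comm.1 (coeff_eq_zero_of_mem ha) hγ

theorem coeff_mul_right_of_mem (a : ReducedCStar G) {b : ReducedCStar G} (hb : b ∈ czeroUnits G)
    (γ : G) : coeff (a * b) γ = coeff a γ * coeff b (d γ) := by
  have e : d (d γ) = d γ := d_unit _ (d_mem γ)
  rw [coeff_mul_of_unique (β := d γ) e.symm, inv_unit (d_mem γ), mul_d]
  intro δ hδ hne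
  rw [← e, ← hδ, d_unit _ (mem_units_of_coeff_ne_zero hb hne)]

theorem coeff_mul_left_of_mem (a : ReducedCStar G) {b : ReducedCStar G} (hb : b ∈ czeroUnits G)
    (γ : G) : coeff (b * a) γ = coeff b (r γ) * coeff a γ := by
  have h : b * a = star (star a * star b) := by rw [star_mul, star_star, star_star]
  rw [h, coeff_star, coeff_mul_right_of_mem _ (star_mem hb), coeff_star, coeff_star, inv_inv',
    d_inv, inv_unit (r_mem γ), star_mul', star_star, star_star, mul_comm]

/-- The norm of a function supported on the unit space is at most the supremum norm. -/
theorem norm_toCStar_le_of_units {f : C_c(G, ℂ)} (hf : ∀ α ∉ units, f α = 0) {C : ℝ} (hC : 0 ≤ C)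
    (h : ∀ α, ‖f α‖ ≤ C) : ‖toCStar f‖ ≤ C := by
  rw [norm_toCStar]
  refine Real.iSup_le (fun x => ?_) hC
  have key : ∀ α β : Fibre x, regKernel f x α β ≠ 0 → α = β := by
    intro α β hne
    have hm : mul α.1 (inv β.1) ∈ units := not_imp_comm.1 (hf _) hne
    have := eq_inv_of_mul_eq ((α.2.trans β.2.symm).trans (r_inv _).symm) hm
    rw [inv_inv'] at this
    exact Subtype.ext this
  -- The kernel is diagonal, so `N = 1` and the general bound `N * C` is just `C`.
  have hb : IsBanded (regKernel (G := G) f x) 1 C :=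
    ⟨hC, fun a b => h _, fun a => ⟨{a}, by simp, fun b hb => by simp [key a b hb]⟩,
      fun a => ⟨{a}, by simp, fun b hb => by simp [key b a hb]⟩⟩
  exact (norm_kernelOp_le (exists_isBanded' f x) hb).trans_eq (by simp)

open Classical in
/-- The restriction of `f` to the unit space, extended by `0`. -/
noncomputable def restrictUnits (hX : IsOpen (units : Set G)) (f : C_c(G, ℂ)) : C_c(G, ℂ) where
  toFun := fun α => if α ∈ units then f α else 0
  continuous_toFun := by
    refine continuous_if (fun α hα => ?_) f.continuous.continuousOn continuousOn_const
    rw [show {a : G | a ∈ units} = units from rfl, frontier_eq_closure_inter_closure,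
      isClosed_units.closure_eq, hX.isClosed_compl.closure_eq] at hα
    exact absurd hα.1 hα.2
  hasCompactSupport' := f.hasCompactSupport.mono fun α hα => by
    simp only [Function.mem_support, ne_eq, ite_eq_right_iff, Classical.not_imp] at hα
    exact hα.2

/-- Restriction to the units, the conditional expectation on `C_c(G)`, is contractive because the
norm on `C_c(G⁽⁰⁾)` is dominated by the supremum norm, which coefficients control. Restricting a
sequence that converges to `a` gives a limit in `C_0(G⁽⁰⁾)` with the same coefficients as `a`. -/
theorem mem_czeroUnits_of_coeff (hX : IsOpen (units : Set G)) {a : ReducedCStar G}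
    (ha : ∀ γ ∉ units, coeff a γ = 0) : a ∈ czeroUnits G := by
  classical
  obtain ⟨f, hf⟩ : ∃ f : ℕ → C_c(G, ℂ), Tendsto (fun n => toCStar (f n)) atTop (𝓝 a) := by
    obtain ⟨u, hu, hlim⟩ := mem_closure_iff_seq_limit.1 (denseRange_toCStar a)
    choose f hf using hu
    exact ⟨f, by simpa only [hf] using hlim⟩
  set g : ℕ → C_c(G, ℂ) := fun n => restrictUnits hX (f n) with hg
  have hg0 : ∀ n, ∀ α ∉ units, g n α = 0 := fun n α hα => if_neg hα
  have hg1 : ∀ n, ∀ α ∈ units, g n α = f n α := fun n α hα => if_pos hα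
  have hC : CauchySeq fun n => toCStar (g n) := by
    rw [Metric.cauchySeq_iff]
    intro ε hε
    obtain ⟨N, hN⟩ := Metric.cauchySeq_iff.1 hf.cauchySeq (ε / 2) (half_pos hε)
    refine ⟨N, fun m hm n hn => ?_⟩
    refine lt_of_le_of_lt ?_ (half_lt_self hε)
    rw [dist_eq_norm, ← map_sub]
    refine norm_toCStar_le_of_units (fun α hα => ?_) (half_pos hε).le fun α => ?_
    · rw [CompactlySupportedContinuousMap.sub_apply, hg0 m α hα, hg0 n α hα, sub_zero]
    · rw [CompactlySupportedContinuousMap.sub_apply]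
      by_cases hα : α ∈ units
      · rw [hg1 m α hα, hg1 n α hα, ← coeff_toCStar, ← coeff_toCStar, ← coeff_sub]
        refine (norm_coeff_le _ _).trans ?_
        rw [← dist_eq_norm]
        exact (hN m hm n hn).le
      · rw [hg0 m α hα, hg0 n α hα, sub_zero, norm_zero]
        exact (half_pos hε).le
  obtain ⟨b, hb⟩ := cauchySeq_tendsto_of_complete hC
  have hbD : b ∈ czeroUnits G :=
    (ccUnits G).isClosed_topologicalClosure.mem_of_tendsto hb
      (Eventually.of_forall fun n => toCStar_mem_czeroUnits (hg0 n))
  have hab : a = b := by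
    refine coeff_ext fun γ => ?_
    by_cases hγ : γ ∈ units
    · have h1 := ((coeffL γ).continuous.tendsto a).comp hf
      have h2 := ((coeffL γ).continuous.tendsto b).comp hb
      refine tendsto_nhds_unique h1 (h2.congr fun n => ?_)
      simp only [Function.comp_apply, coeffL_apply, coeff_toCStar]
      exact hg1 n γ hγ
    · rw [ha γ hγ, coeff_eq_zero_of_mem hbD hγ]
  rwa [hab]

end Coefficients

/-! ### Bump functions, bisections and characters -/

section Bump

variable {X : Type*} [TopologicalSpace X] [T2Space X] [LocallyCompactSpace X]

theorem exists_bump {U : Set X} (hU : IsOpen U) {x : X} (hx : x ∈ U) :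
    ∃ f : C_c(X, ℂ), f x = 1 ∧ ∀ y ∉ U, f y = 0 := by
  obtain ⟨f, hf1, hf0, hfc, -⟩ := exists_continuous_one_zero_of_isCompact
    (isCompact_singleton (x := x)) hU.isClosed_compl (Set.disjoint_singleton_left.2 fun h => h hx)
  refine ⟨⟨⟨fun y => (f y : ℂ), by fun_prop⟩, hfc.comp_left (g := ((↑) : ℝ → ℂ)) rfl⟩, ?_, ?_⟩
  · change ((f x : ℝ) : ℂ) = 1
    rw [hf1 rfl]; simp
  · intro y hy
    change ((f y : ℝ) : ℂ) = 0
    rw [hf0 hy]; simp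

theorem cc_separates {x y : X} (h : ∀ f : C_c(X, ℂ), f x = 0 → f y = 0) : y = x := by
  by_contra hne
  obtain ⟨f, hf1, hf0⟩ := exists_bump (isOpen_compl_singleton (x := x)) (x := y) hne
  have := h f (hf0 x (fun h => h rfl))
  rw [hf1] at this
  exact one_ne_zero this

end Bump

section Bisection

variable {G : Type*} [TopologicalSpace G] [ArrowGroupoid G]

/-- A subset of a groupoid on which the domain and the range map are injective. -/
def IsBisection (S : Set G) : Prop := Set.InjOn d S ∧ Set.InjOn r S

theorem IsBisection.mono {S T : Set G} (hT : IsBisection T) (h : S ⊆ T) : IsBisection S :=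
  ⟨hT.1.mono h, hT.2.mono h⟩

theorem isOpen_units (hG : IsEffective G) : IsOpen (units : Set G) := by
  rw [← show interior (iso G) = units from hG]
  exact isOpen_interior

variable [IsEtale G]

theorem exists_open_bisection (γ : G) : ∃ U : Set G, IsOpen U ∧ γ ∈ U ∧ IsBisection U := by
  obtain ⟨e, he, hde⟩ := IsEtale.isLocalHomeomorph_d (G := G) γ
  obtain ⟨e', he', hre⟩ := isLocalHomeomorph_r G γ
  refine ⟨e.source ∩ e'.source, e.open_source.inter e'.open_source, ⟨he, he'⟩, ?_, ?_⟩
  · intro α hα β hβ h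
    refine e.injOn hα.1 hβ.1 ?_
    rw [← hde]
    exact Subtype.ext h
  · intro α hα β hβ h
    refine e'.injOn hα.2 hβ.2 ?_
    rw [← hre]
    exact Subtype.ext h

variable [T2Space G] [LocallyCompactSpace G]

theorem exists_bisection_bump (γ : G) :
    ∃ f : C_c(G, ℂ), f γ = 1 ∧ IsBisection (Function.support f) := by
  obtain ⟨U, hU, hγ, hb⟩ := exists_open_bisection γ
  obtain ⟨f, h1, h0⟩ := exists_bump hU hγ
  exact ⟨f, h1, hb.mono fun α hα => not_imp_comm.1 (h0 α) hα⟩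

/-- Every function in `C_c(G)` is a finite sum of functions supported on bisections. -/
theorem exists_sum_bisection (f : C_c(G, ℂ)) :
    ∃ (n : ℕ) (g : Fin n → C_c(G, ℂ)), f = ∑ i, g i ∧
      ∀ i, IsBisection (Function.support (g i)) := by
  choose U hU hγ hb using exists_open_bisection (G := G)
  obtain ⟨t, -, ht⟩ := f.hasCompactSupport.isCompact.elim_nhds_subcover U
    fun γ _ => (hU γ).mem_nhds (hγ γ)
  set e := t.equivFin.symm
  obtain ⟨p, hp1, hp2, -, -⟩ := exists_continuous_sum_one_of_isOpen_isCompact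
    (s := fun i : Fin t.card => U (e i)) (fun i => hU _) f.hasCompactSupport.isCompact (by
      intro γ hγ
      obtain ⟨α, hα, h⟩ := Set.mem_iUnion₂.1 (ht hγ)
      exact Set.mem_iUnion.2 ⟨e.symm ⟨α, hα⟩, by simpa using h⟩)
  refine ⟨t.card, fun i => ⟨⟨fun γ => (p i γ : ℂ) * f γ, by fun_prop⟩,
    f.hasCompactSupport.mul_left⟩, ?_, fun i => ?_⟩
  · ext γ
    rw [CompactlySupportedContinuousMap.sum_apply]
    change f γ = ∑ i, (p i γ : ℂ) * f γ
    rw [← Finset.sum_mul, ← Complex.ofReal_sum]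
    by_cases h : f γ = 0
    · rw [h, mul_zero]
    · have := hp2 (subset_tsupport _ h)
      simp only [Finset.sum_apply, Pi.one_apply] at this
      rw [this, Complex.ofReal_one, one_mul]
  · refine (hb (e i)).mono fun γ hγ => hp1 i (subset_tsupport _ fun h => hγ ?_)
    change (p i γ : ℂ) * f γ = 0
    rw [h, Complex.ofReal_zero, zero_mul]

theorem coeff_star_mul_self_of_mem {a : ReducedCStar G} (ha : a ∈ czeroUnits G) {z : G}
    (hz : z ∈ units) : coeff (star a * a) z = ((‖coeff a z‖ ^ 2 : ℝ) : ℂ) := by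
  rw [coeff_mul_right_of_mem _ ha, coeff_star, d_unit _ hz, inv_unit hz, Complex.ofReal_pow]
  exact Complex.conj_mul' _

/-- The non-zero characters of `C_0(G⁽⁰⁾)` are the evaluations at units. -/
theorem exists_eq_coeff_of_character (hX : IsOpen (units : Set G)) (χ : ReducedCStar G →L[ℂ] ℂ)
    (hmul : ∀ a ∈ czeroUnits G, ∀ b ∈ czeroUnits G, χ (a * b) = χ a * χ b)
    (hne : ∃ a ∈ czeroUnits G, χ a ≠ 0) :
    ∃ y ∈ (units : Set G), ∀ a ∈ czeroUnits G, χ a = coeff a y := by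
  have key : ∃ y ∈ (units : Set G), ∀ a ∈ czeroUnits G, χ a = 0 → coeff a y = 0 := by
    by_contra! hcon
    obtain ⟨g, hg0, hgχ⟩ : ∃ g : C_c(G, ℂ), (∀ α ∉ units, g α = 0) ∧ χ (toCStar g) ≠ 0 := by
      by_contra! h
      obtain ⟨a, ha, ha'⟩ := hne
      refine ha' (closure_minimal (t := {a | χ a = 0}) ?_ ?_ ha)
      · rintro _ ⟨g, hg, rfl⟩
        exact h g hg
      · exact isClosed_eq χ.continuous continuous_const
    choose! a haD haχ hay using hcon
    have hK : tsupport g ⊆ units :=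
      closure_minimal (fun α hα => not_imp_comm.1 (hg0 α) hα) isClosed_units
    obtain ⟨t, ht⟩ := g.hasCompactSupport.isCompact.elim_nhds_subcover'
      (fun y _ => {z | coeff (a y) z ≠ 0})
      fun y hy => (isOpen_ne_fun (continuous_coeff _) continuous_const).mem_nhds (hay y (hK hy))
    -- `F` lies in the kernel of `χ` but is strictly positive on the support of `g`. Dividing gives
    -- `g = (g / F) F`, so `χ g = 0`, a contradiction.
    set F : ReducedCStar G := ∑ y ∈ t, star (a y) * a y with hF
    have hFD : F ∈ czeroUnits G :=
      sum_mem fun y _ => mul_mem (star_mem (haD y (hK y.2))) (haD y (hK y.2))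
    have hχF : χ F = 0 := by
      rw [hF, map_sum]
      refine Finset.sum_eq_zero fun y _ => ?_
      rw [hmul _ (star_mem (haD y (hK y.2))) _ (haD y (hK y.2)), haχ y (hK y.2), mul_zero]
    have hF0 : ∀ z ∈ tsupport g, coeff F z ≠ 0 := by
      intro z hz
      obtain ⟨y, hy, hyz⟩ := Set.mem_iUnion₂.1 (ht hz)
      rw [hF, coeff_sum, Finset.sum_congr rfl fun (y : tsupport g) _ =>
        coeff_star_mul_self_of_mem (haD y (hK y.2)) (hK hz), ← Complex.ofReal_sum,
        Complex.ofReal_ne_zero]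
      refine ne_of_gt (Finset.sum_pos' (fun _ _ => by positivity) ⟨y, hy, ?_⟩)
      have := norm_pos_iff.2 (show coeff (a y) z ≠ 0 from hyz)
      positivity
    have hsub : tsupport (fun z => g z / coeff F z) ⊆ tsupport g :=
      closure_mono fun z hz h => hz (by simp [h])
    let q : C_c(G, ℂ) :=
      { toFun := fun z => g z / coeff F z
        continuous_toFun := continuous_of_tsupport fun z hz =>
          g.continuous.continuousAt.div (continuous_coeff F).continuousAt (hF0 z (hsub hz))
        hasCompactSupport' := g.hasCompactSupport.of_isClosed_subset (isClosed_tsupport _) hsub }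
    have hq : ∀ z, q z = g z / coeff F z := fun _ => rfl
    have hqD : toCStar q ∈ czeroUnits G :=
      toCStar_mem_czeroUnits fun α hα => by rw [hq, hg0 α hα, zero_div]
    refine hgχ ?_
    have : toCStar g = toCStar q * F := by
      refine coeff_ext fun γ => ?_
      rw [coeff_mul_right_of_mem _ hFD, coeff_toCStar, coeff_toCStar, hq]
      by_cases h : g γ = 0
      · rw [h, zero_div, zero_mul]
      · rw [d_unit _ (hK (subset_tsupport _ h)), div_mul_cancel₀ _ (hF0 γ (subset_tsupport _ h))]
    rw [this, hmul _ hqD _ hFD, hχF, mul_zero]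
  obtain ⟨y, hy, h⟩ := key
  obtain ⟨e₀, he₀, hne₀⟩ := hne
  set e := (χ e₀)⁻¹ • e₀ with he_def
  have he : e ∈ czeroUnits G := SMulMemClass.smul_mem _ he₀
  have hχe : χ e = 1 := by rw [he_def, map_smul, smul_eq_mul, inv_mul_cancel₀ hne₀]
  -- Since `a - χ(a) e` is killed by `χ`, evaluation at `y` is `χ` times the constant `coeff e y`.
  -- Multiplicativity makes this constant 0 or 1, and a bump at `y` excludes 0.
  have h1 : ∀ a ∈ czeroUnits G, coeff a y = χ a * coeff e y := fun a ha => by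
    have := h (a - χ a • e) (sub_mem ha (SMulMemClass.smul_mem _ he))
      (by rw [map_sub, map_smul, hχe, smul_eq_mul, mul_one, sub_self])
    rwa [coeff_sub, coeff_smul, sub_eq_zero] at this
  have h2 : coeff e y = 1 := by
    have h3 := h1 (e * e) (mul_mem he he)
    rw [hmul _ he _ he, hχe, coeff_mul_right_of_mem _ he, d_unit _ hy, one_mul, one_mul] at h3
    refine (mul_eq_right₀ fun h0 => ?_).1 h3
    obtain ⟨f, hf1, hf0⟩ := exists_bump hX hy
    have h4 := h1 (toCStar f) (toCStar_mem_czeroUnits hf0)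
    rw [h0, mul_zero, coeff_toCStar, hf1] at h4
    exact one_ne_zero h4
  exact ⟨y, hy, fun a ha => by rw [h1 a ha, h2, mul_one]⟩

end Bisection

/-! ### Automorphisms which preserve `C_0(G⁽⁰⁾)` are weighted composition operators -/

section Bisections

variable {G : Type*} [TopologicalSpace G] [ArrowGroupoid G] [IsEtale G] [T2Space G]

theorem isOpenMap_r (hX : IsOpen (units : Set G)) : IsOpenMap (r : G → G) :=
  hX.isOpenMap_subtype_val.comp (isLocalHomeomorph_r G).isOpenMap

theorem isOpen_support_coeff (a : ReducedCStar G) : IsOpen (Function.support (coeff a)) :=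
  (continuous_coeff a).isOpen_support

theorem isBisection_support_star {a : ReducedCStar G}
    (ha : IsBisection (Function.support (coeff a))) :
    IsBisection (Function.support (coeff (star a))) := by
  have h : ∀ γ ∈ Function.support (coeff (star a)), inv γ ∈ Function.support (coeff a) := by
    intro γ hγ h0
    refine hγ ?_
    rw [coeff_star, h0, star_zero]
  constructor
  · intro α hα β hβ e
    rw [← inv_inv' α, ← inv_inv' β]
    exact congrArg inv (ha.2 (h α hα) (h β hβ) (by rwa [r_inv, r_inv]))
  · intro α hα β hβ e
    rw [← inv_inv' α, ← inv_inv' β]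
    exact congrArg inv (ha.1 (h α hα) (h β hβ) (by rwa [d_inv, d_inv]))

theorem coeff_mul_eq_zero {a b : ReducedCStar G} {γ : G} (h : ∀ δ, d δ = d γ → coeff b δ = 0) :
    coeff (a * b) γ = 0 := by
  rw [coeff_mul_of_unique (β := γ) rfl fun δ hδ hne => absurd (h δ hδ) hne, h γ rfl, mul_zero]

theorem coeff_mul_of_isBisection {a b : ReducedCStar G}
    (hb : IsBisection (Function.support (coeff b))) {γ β : G} (hd : d γ = d β)
    (hβ : coeff b β ≠ 0) : coeff (a * b) γ = coeff a (mul γ (inv β)) * coeff b β :=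
  coeff_mul_of_unique hd fun _ hδ hne => hb.1 hne hβ hδ

theorem exists_of_coeff_mul_ne_zero {a b : ReducedCStar G}
    (hb : IsBisection (Function.support (coeff b))) {γ : G} (h : coeff (a * b) γ ≠ 0) :
    ∃ β, d γ = d β ∧ coeff b β ≠ 0 ∧ coeff a (mul γ (inv β)) ≠ 0 := by
  by_cases hc : ∃ β, d β = d γ ∧ coeff b β ≠ 0
  · obtain ⟨β, hβ, hne⟩ := hc
    rw [coeff_mul_of_isBisection hb hβ.symm hne] at h
    exact ⟨β, hβ.symm, hne, left_ne_zero_of_mul h⟩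
  · push Not at hc
    exact absurd (coeff_mul_eq_zero hc) h

section StarMul

variable {a c : ReducedCStar G} (ha : IsBisection (Function.support (coeff a)))
  (hc : Function.support (coeff c) ⊆ Function.support (coeff a))
include ha hc

/-- A non-zero coefficient at `δ` gives `β` and `β δ⁻¹` with equal range, both in the support of
`a`. They coincide, so `δ` is a unit. -/
theorem star_mul_mem_czeroUnits (hX : IsOpen (units : Set G)) : star a * c ∈ czeroUnits G := by
  refine mem_czeroUnits_of_coeff hX fun δ hδ => ?_
  by_contra hne
  obtain ⟨β, hβ, h1, h2⟩ := exists_of_coeff_mul_ne_zero (ha.mono hc) hne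
  rw [coeff_star, mul_inv_rev hβ, ne_eq, star_eq_zero] at h2
  have h3 := ha.2 h2 (hc h1) (r_mul_inv hβ.symm)
  have h4 := inv_mul_cancel_left (α := β) (β := inv δ) (by rw [r_inv, hβ])
  rw [h3, inv_mul] at h4
  refine hδ ?_
  rw [← inv_inv' δ, ← h4, inv_unit (d_mem β)]
  exact d_mem β

theorem coeff_star_mul_d {γ : G} (hγ : coeff a γ ≠ 0) :
    coeff (star a * c) (d γ) = star (coeff a γ) * coeff c γ := by
  have e : d (d γ) = d γ := d_unit _ (d_mem γ)
  rw [coeff_mul_of_unique (β := γ) e fun δ hδ hne => ha.1 (hc hne) hγ hδ, coeff_star,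
    mul_inv_rev e, inv_unit (d_mem γ), mul_d]

end StarMul

theorem units_separated [LocallyCompactSpace G] (hX : IsOpen (units : Set G)) {x y : G}
    (hy : y ∈ units) (h : ∀ a ∈ czeroUnits G, coeff a x = coeff a y) : x = y := by
  by_contra hne
  obtain ⟨f, hf1, hf0⟩ := exists_bump (hX.inter (isOpen_compl_singleton (x := x))) (x := y)
    ⟨hy, fun h => hne h.symm⟩
  have := h (toCStar f) (toCStar_mem_czeroUnits fun α hα => hf0 α fun h => hα h.1)
  rw [coeff_toCStar, coeff_toCStar, hf1, hf0 x fun h => h.2 rfl] at this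
  exact zero_ne_one this

end Bisections

/-! ### The dual map on units and the images of elements supported on bisections. -/

section Automorphism

variable {G : Type*} [TopologicalSpace G] [ArrowGroupoid G] [IsEtale G] [T2Space G]

theorem continuous_starAlgEquiv (φ : ReducedCStar G ≃⋆ₐ[ℂ] ReducedCStar G) : Continuous φ :=
  (StarAlgEquiv.isometry φ).continuous

theorem apply_mem_czeroUnits {φ : ReducedCStar G ≃⋆ₐ[ℂ] ReducedCStar G}
    (hφ : φ ∈ starAutPreserving (czeroUnits G)) {a : ReducedCStar G} (ha : a ∈ czeroUnits G) :
    φ a ∈ czeroUnits G := by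
  have : φ a ∈ φ '' (czeroUnits G : Set (ReducedCStar G)) := ⟨a, ha, rfl⟩
  rwa [show φ '' (czeroUnits G : Set (ReducedCStar G)) = czeroUnits G from hφ] at this

theorem symm_mem_starAutPreserving {φ : ReducedCStar G ≃⋆ₐ[ℂ] ReducedCStar G}
    (hφ : φ ∈ starAutPreserving (czeroUnits G)) : φ.symm ∈ starAutPreserving (czeroUnits G) :=
  inv_mem hφ

/-- `k` is the map of the unit space which is dual to the restriction of `φ` to `C_0(G⁽⁰⁾)`. -/
def IsDualMap (φ : ReducedCStar G ≃⋆ₐ[ℂ] ReducedCStar G) (k : G → G) : Prop :=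
  ∀ x ∈ units, k x ∈ units ∧ ∀ a ∈ czeroUnits G, coeff (φ a) x = coeff a (k x)

variable [LocallyCompactSpace G]

/-- For each unit `x`, `a ↦ (φ a)(x)` is a character of `C_0(G⁽⁰⁾)`. It is non-zero because `φ⁻¹`
also preserves the subalgebra and so supplies preimages of bumps. -/
theorem exists_isDualMap (hX : IsOpen (units : Set G))
    {φ : ReducedCStar G ≃⋆ₐ[ℂ] ReducedCStar G} (hφ : φ ∈ starAutPreserving (czeroUnits G)) :
    ∃ k : G → G, IsDualMap φ k := by
  have : ∀ x ∈ (units : Set G), ∃ y ∈ (units : Set G), ∀ a ∈ czeroUnits G,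
      coeff (φ a) x = coeff a y := by
    intro x hx
    refine exists_eq_coeff_of_character hX
      ⟨⟨⟨fun a => coeff (φ a) x, fun a b => ?_⟩, fun z a => ?_⟩, ?_⟩ ?_ ?_
    · rw [map_add, coeff_add]
    · simp only [map_smul, coeff_smul]
      rfl
    · exact (coeffL x).continuous.comp (continuous_starAlgEquiv φ)
    · intro a ha b hb
      change coeff (φ (a * b)) x = coeff (φ a) x * coeff (φ b) x
      rw [map_mul, coeff_mul_right_of_mem _ (apply_mem_czeroUnits hφ hb), d_unit _ hx]
    · obtain ⟨f, hf1, hf0⟩ := exists_bump hX hx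
      refine ⟨φ.symm (toCStar f), apply_mem_czeroUnits (symm_mem_starAutPreserving hφ)
        (toCStar_mem_czeroUnits hf0), ?_⟩
      change coeff (φ (φ.symm (toCStar f))) x ≠ 0
      rw [StarAlgEquiv.apply_symm_apply, coeff_toCStar, hf1]
      exact one_ne_zero
  choose! k hk using this
  exact ⟨k, hk⟩

section

variable {φ : ReducedCStar G ≃⋆ₐ[ℂ] ReducedCStar G}

theorem IsDualMap.left_inv (hX : IsOpen (units : Set G))
    (hφ : φ ∈ starAutPreserving (czeroUnits G)) {k l : G → G} (hk : IsDualMap φ k)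
    (hl : IsDualMap φ.symm l) {x : G} (hx : x ∈ units) : l (k x) = x := by
  refine (units_separated hX (hl _ (hk x hx).1).1 fun a ha => ?_).symm
  rw [← (hl _ (hk x hx).1).2 a ha,
    ← (hk x hx).2 _ (apply_mem_czeroUnits (symm_mem_starAutPreserving hφ) ha),
    StarAlgEquiv.apply_symm_apply]

theorem IsDualMap.injOn (hX : IsOpen (units : Set G))
    (hφ : φ ∈ starAutPreserving (czeroUnits G)) {k : G → G} (hk : IsDualMap φ k) :
    Set.InjOn k units := by
  obtain ⟨l, hl⟩ := exists_isDualMap hX (symm_mem_starAutPreserving hφ)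
  intro x hx y hy h
  rw [← hk.left_inv hX hφ hl hx, h, hk.left_inv hX hφ hl hy]

/-- The source condition comes from `a* a`, which lies in `C_0(G⁽⁰⁾)` and does not vanish at `k (d
δ)`. For the range, `φ` is applied to an identity that moves `f ∈ C_0(G⁽⁰⁾)` from the left of `a` to
its right; comparing values at `δ` gives `f (k (r δ)) = f (r γ)` for all `f`. -/
theorem exists_of_coeff_apply_ne_zero (hX : IsOpen (units : Set G))
    (hφ : φ ∈ starAutPreserving (czeroUnits G)) {k : G → G} (hk : IsDualMap φ k)
    {a : ReducedCStar G} (ha : IsBisection (Function.support (coeff a))) {δ : G}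
    (hδ : coeff (φ a) δ ≠ 0) : ∃ γ, coeff a γ ≠ 0 ∧ d γ = k (d δ) ∧ r γ = k (r δ) := by
  have hP := star_mul_mem_czeroUnits ha subset_rfl hX
  have hPx : coeff (star a * a) (k (d δ)) ≠ 0 := by
    rw [← (hk _ (d_mem δ)).2 _ hP, map_mul, map_star]
    exact coeff_star_mul_self_ne_zero hδ
  obtain ⟨γ, hγ, hne, -⟩ := exists_of_coeff_mul_ne_zero ha hPx
  rw [d_unit _ (hk _ (d_mem δ)).1] at hγ
  refine ⟨γ, hne, hγ.symm, (units_separated hX (r_mem γ) fun f hf => ?_).symm⟩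
  have hc : Function.support (coeff (f * a)) ⊆ Function.support (coeff a) := by
    intro γ hγ
    rw [Function.mem_support, coeff_mul_left_of_mem _ hf] at hγ
    exact right_ne_zero_of_mul hγ
  have hQ := star_mul_mem_czeroUnits ha hc hX
  -- On a bisection the left action of `f` is a right action: `a* f a` is `a* a` weighted by `f`
  -- transported from range to source.
  have hPQ : f * (a * (star a * a)) = a * (star a * (f * a)) := by
    refine coeff_ext fun ε => ?_
    rw [coeff_mul_left_of_mem _ hf, coeff_mul_right_of_mem _ hP, coeff_mul_right_of_mem _ hQ]
    by_cases hε : coeff a ε = 0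
    · rw [hε]; ring
    · rw [coeff_star_mul_d ha subset_rfl hε, coeff_star_mul_d ha hc hε,
        coeff_mul_left_of_mem _ hf]
      ring
  have h := congrArg (fun b => coeff (φ b) δ) hPQ
  simp only [map_mul φ f, map_mul φ a] at h
  rw [coeff_mul_left_of_mem _ (apply_mem_czeroUnits hφ hf),
    coeff_mul_right_of_mem _ (apply_mem_czeroUnits hφ hP),
    coeff_mul_right_of_mem _ (apply_mem_czeroUnits hφ hQ), (hk _ (r_mem δ)).2 _ hf,
    (hk _ (d_mem δ)).2 _ hP, (hk _ (d_mem δ)).2 _ hQ, hγ, coeff_star_mul_d ha hc hne,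
    coeff_star_mul_d ha subset_rfl hne, coeff_mul_left_of_mem _ hf] at h
  have hne' : coeff (φ a) δ * (star (coeff a γ) * coeff a γ) ≠ 0 :=
    mul_ne_zero hδ (mul_ne_zero (star_ne_zero.2 hne) hne)
  refine mul_right_cancel₀ hne' ?_
  linear_combination h

/-- Arrows in the support of `φ a` with equal source have equal range, since `a` lives on a
bisection and `k` is injective. Only isotropy could separate them, and effectiveness rules that out.
-/
theorem injOn_d_support_coeff_apply (hG : IsEffective G)
    (hφ : φ ∈ starAutPreserving (czeroUnits G)) {a : ReducedCStar G}
    (ha : IsBisection (Function.support (coeff a))) :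
    Set.InjOn d (Function.support (coeff (φ a))) := by
  have hX := isOpen_units hG
  obtain ⟨k, hk⟩ := exists_isDualMap hX hφ
  have hr : ∀ α β, coeff (φ a) α ≠ 0 → coeff (φ a) β ≠ 0 → d α = d β → r α = r β := by
    intro α β hα hβ h
    obtain ⟨α₁, h1, h2, h3⟩ := exists_of_coeff_apply_ne_zero hX hφ hk ha hα
    obtain ⟨β₁, h4, h5, h6⟩ := exists_of_coeff_apply_ne_zero hX hφ hk ha hβ
    have e := ha.1 h1 h4 (by rw [h2, h5, h])
    exact hk.injOn hX hφ (r_mem α) (r_mem β) (by rw [← h3, ← h6, e])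
  intro α hα β hβ h
  -- A bump `g` at `β⁻¹`, supported on a bisection and on inverses of arrows where `φ a` is
  -- non-zero, forces `φ a * g` to have its open support inside the isotropy, hence inside the
  -- units. Its value at `αβ⁻¹` is that of `φ a` at `α`.
  obtain ⟨U, hU, hβU, hUb⟩ := exists_open_bisection (inv β)
  obtain ⟨g, hg1, hg0⟩ := exists_bump (hU.inter ((isOpen_support_coeff (φ a)).preimage
    (IsEtale.continuous_inv (G := G)))) (x := inv β) ⟨hβU, by rwa [Set.mem_preimage, inv_inv']⟩
  have hg : ∀ γ, coeff (toCStar g) γ ≠ 0 → γ ∈ U ∧ coeff (φ a) (inv γ) ≠ 0 := fun γ hγ => by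
    rw [coeff_toCStar] at hγ
    exact not_imp_comm.1 (hg0 γ) hγ
  have hgb : IsBisection (Function.support (coeff (toCStar g))) := hUb.mono fun γ hγ => (hg γ hγ).1
  have hsub : Function.support (coeff (φ a * toCStar g)) ⊆ iso G := by
    intro δ hδ
    obtain ⟨γ, hγ, h1, h2⟩ := exists_of_coeff_mul_ne_zero hgb hδ
    have h3 := hr _ _ h2 (hg γ h1).2 (by rw [d_mul_inv hγ, d_inv])
    rw [r_mul_inv hγ, r_inv] at h3
    exact hγ.trans h3.symm
  have hmem : mul α (inv β) ∈ Function.support (coeff (φ a * toCStar g)) := by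
    have e : d (mul α (inv β)) = d (inv β) := by rw [d_mul_inv h, d_inv]
    have h1 : coeff (toCStar g) (inv β) = 1 := by rw [coeff_toCStar, hg1]
    rw [Function.mem_support, coeff_mul_of_isBisection hgb e (by rw [h1]; exact one_ne_zero), h1,
      mul_one, inv_inv', inv_mul_cancel_right h]
    exact hα
  have hunit : mul α (inv β) ∈ units := by
    rw [← show interior (iso G) = units from hG]
    exact interior_maximal hsub (isOpen_support_coeff _) hmem
  rw [eq_inv_of_mul_eq (h.trans (r_inv β).symm) hunit, inv_inv']

theorem isBisection_support_coeff_apply (hG : IsEffective G)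
    (hφ : φ ∈ starAutPreserving (czeroUnits G)) {a : ReducedCStar G}
    (ha : IsBisection (Function.support (coeff a))) :
    IsBisection (Function.support (coeff (φ a))) := by
  refine ⟨injOn_d_support_coeff_apply hG hφ ha, fun α hα β hβ h => ?_⟩
  have hs := injOn_d_support_coeff_apply hG hφ (isBisection_support_star ha)
  have hm : ∀ γ, coeff (φ a) γ ≠ 0 → inv γ ∈ Function.support (coeff (φ (star a))) := by
    intro γ hγ
    rw [Function.mem_support, map_star, coeff_star, inv_inv']
    exact star_ne_zero.2 hγ
  rw [← inv_inv' α, ← inv_inv' β, hs (hm α hα) (hm β hβ) (by rw [d_inv, d_inv, h])]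

/-- Elements supported on bisections which are both non-zero at `γ` have images which are both
non-zero at the same arrow, with the same sesquilinear pairing. -/
theorem coeff_apply_pairing (hG : IsEffective G) (hφ : φ ∈ starAutPreserving (czeroUnits G))
    {k : G → G} (hk : IsDualMap φ k) {a b : ReducedCStar G}
    (ha : IsBisection (Function.support (coeff a))) (hb : IsBisection (Function.support (coeff b)))
    {γ α β : G} (haγ : coeff a γ ≠ 0) (hbγ : coeff b γ ≠ 0) (hα : coeff (φ a) α ≠ 0)
    (hβ : coeff (φ b) β ≠ 0) (hr : r α = r β) (hkr : r γ = k (r α)) :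
    α = β ∧ star (coeff (φ a) α) * coeff (φ b) β = star (coeff a γ) * coeff b γ := by
  have hX := isOpen_units hG
  -- Cutting down by `f` confines `f b` to the support of `a`, so that `a* f b` lies in `C_0(G⁽⁰⁾)`,
  -- while `f` is 1 at `r γ`.
  obtain ⟨f, hf1, hf0⟩ := exists_bump (isOpenMap_r hX _
    ((isOpen_support_coeff a).inter (isOpen_support_coeff b)))
    (x := r γ) ⟨γ, ⟨haγ, hbγ⟩, rfl⟩
  have hfu : ∀ δ ∉ units, f δ = 0 := fun δ hδ => hf0 δ (by
    rintro ⟨ε, -, rfl⟩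
    exact hδ (r_mem ε))
  have hf := toCStar_mem_czeroUnits hfu
  have hc : Function.support (coeff (toCStar f * b)) ⊆ Function.support (coeff a) := by
    intro δ hδ
    rw [Function.mem_support, coeff_mul_left_of_mem _ hf, coeff_toCStar] at hδ
    obtain ⟨ε, ⟨h1, h2⟩, h3⟩ := not_imp_comm.1 (hf0 _) (left_ne_zero_of_mul hδ)
    rwa [← hb.2 h2 (right_ne_zero_of_mul hδ) h3]
  have hD := star_mul_mem_czeroUnits ha hc hX
  have hφf : coeff (φ (toCStar f)) (r β) = 1 := by
    rw [← hr, (hk _ (r_mem α)).2 _ hf, ← hkr, coeff_toCStar, hf1]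
  have hfβ : coeff (φ (toCStar f) * φ b) β = coeff (φ b) β := by
    rw [coeff_mul_left_of_mem _ (apply_mem_czeroUnits hφ hf), hφf, one_mul]
  have hbis : IsBisection (Function.support (coeff (φ (toCStar f) * φ b))) := by
    rw [← map_mul]
    exact isBisection_support_coeff_apply hG hφ (ha.mono hc)
  -- This value is non-zero, whereas `φ (a* f b)` lives on the units. So `α⁻¹β` is a unit, and
  -- evaluating through `k` at `d α` gives the pairing.
  have hval : coeff (φ (star a * (toCStar f * b))) (mul (inv α) β) =
      star (coeff (φ a) α) * coeff (φ b) β := by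
    rw [map_mul, map_mul, map_star, coeff_mul_of_isBisection hbis (d_inv_mul hr)
      (by rwa [hfβ]), hfβ, coeff_star, mul_inv_cancel_right ((d_inv α).trans hr), inv_inv']
  have hu : mul (inv α) β ∈ units :=
    mem_units_of_coeff_ne_zero (apply_mem_czeroUnits hφ hD)
      (by rw [hval]; exact mul_ne_zero (star_ne_zero.2 hα) hβ)
  have hαβ : α = β := by
    have := eq_inv_of_mul_eq ((d_inv α).trans hr) hu
    rw [← inv_inv' α, this, inv_inv']
  refine ⟨hαβ, ?_⟩
  obtain ⟨γ₀, h1, h2, h3⟩ := exists_of_coeff_apply_ne_zero hX hφ hk ha hα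
  have hγ₀ : γ₀ = γ := ha.2 h1 haγ (by rw [h3, hkr])
  subst hγ₀
  rw [← hval, ← hαβ, inv_mul, (hk _ (d_mem α)).2 _ hD, ← h2, coeff_star_mul_d ha hc haγ,
    coeff_mul_left_of_mem _ hf, coeff_toCStar, hf1, one_mul]

/-- `φ` acts on coefficients as `a ↦ w · (a ∘ θ)`, where the fibres of `θ` are governed by a map of
the unit space. -/
structure IsWeightedComp (φ : ReducedCStar G ≃⋆ₐ[ℂ] ReducedCStar G) (k θ : G → G)
    (w : G → Circle) : Prop where
  d_eq : ∀ γ, d (θ γ) = k (d γ)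
  r_eq : ∀ γ, r (θ γ) = k (r γ)
  coeff_eq : ∀ a γ, coeff (φ a) γ = w γ * coeff a (θ γ)

/-- An automorphism of `C*_r(G)` which preserves `C_0(G⁽⁰⁾)` is a unimodular weighted composition
operator. -/
theorem exists_weighted_comp (hG : IsEffective G) (hφ : φ ∈ starAutPreserving (czeroUnits G)) :
    ∃ (k θ : G → G) (w : G → Circle), IsWeightedComp φ k θ w := by
  have hX := isOpen_units hG
  have hφ' := symm_mem_starAutPreserving hφ
  obtain ⟨k, hk⟩ := exists_isDualMap hX hφ
  obtain ⟨l, hl⟩ := exists_isDualMap hX hφ'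
  have h : ∀ γ, ∃ (a : ReducedCStar G) (δ : G), IsBisection (Function.support (coeff a)) ∧
      coeff (φ a) γ ≠ 0 ∧ coeff a δ ≠ 0 ∧ d δ = k (d γ) ∧ r δ = k (r γ) := by
    intro γ
    obtain ⟨f, hf1, hfb⟩ := exists_bisection_bump γ
    have hb : IsBisection (Function.support (coeff (toCStar f))) :=
      hfb.mono fun α hα => by rwa [Function.mem_support, coeff_toCStar] at hα
    have ha := isBisection_support_coeff_apply hG hφ' hb
    have hγ : coeff (φ (φ.symm (toCStar f))) γ ≠ 0 := by
      rw [StarAlgEquiv.apply_symm_apply, coeff_toCStar, hf1]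
      exact one_ne_zero
    obtain ⟨δ, h1, h2⟩ := exists_of_coeff_apply_ne_zero hX hφ hk ha hγ
    exact ⟨_, δ, ha, hγ, h1, h2⟩
  choose a θ hab haγ haθ hdθ hrθ using h
  -- Pairing `a γ` with itself shows that the quotient chosen as weight has modulus 1.
  have hpair : ∀ γ, star (coeff (φ (a γ)) γ) * coeff (φ (a γ)) γ =
      star (coeff (a γ) (θ γ)) * coeff (a γ) (θ γ) := fun γ =>
    (coeff_apply_pairing hG hφ hk (hab γ) (hab γ) (haθ γ) (haθ γ) (haγ γ) (haγ γ) rfl (hrθ γ)).2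
  have hnorm : ∀ γ, ‖coeff (φ (a γ)) γ / coeff (a γ) (θ γ)‖ = 1 := by
    intro γ
    have h1 := congrArg norm (hpair γ)
    rw [norm_mul, norm_mul, norm_star, norm_star] at h1
    rw [norm_div, div_eq_one_iff_eq (norm_ne_zero_iff.2 (haθ γ))]
    exact (mul_self_inj (norm_nonneg _) (norm_nonneg _)).1 h1
  refine ⟨k, θ, fun γ => ⟨_, mem_sphere_zero_iff_norm.2 (hnorm γ)⟩,
    hdθ, hrθ, ?_⟩
  have hB : ∀ b, IsBisection (Function.support (coeff b)) → ∀ γ,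
      coeff (φ b) γ = coeff (φ (a γ)) γ / coeff (a γ) (θ γ) * coeff b (θ γ) := by
    intro b hb γ
    have hφa := isBisection_support_coeff_apply hG hφ (hab γ)
    have hφb := isBisection_support_coeff_apply hG hφ hb
    have hlr : r γ = l (r (θ γ)) := by rw [hrθ, hk.left_inv hX hφ hl (r_mem γ)]
    by_cases hbγ : coeff (φ b) γ = 0
    · rw [hbγ, zero_eq_mul]
      right
      by_contra hbθ
      -- If `b` were non-zero at `θ γ`, then `φ b` would be non-zero at some arrow with range `r γ`.
      -- The pairing identifies that arrow with `γ`, where `φ b` vanishes.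
      obtain ⟨δ, h1, -, h3⟩ := exists_of_coeff_apply_ne_zero hX hφ' hl hφb (δ := θ γ)
        (by rwa [StarAlgEquiv.symm_apply_apply])
      have := (coeff_apply_pairing hG hφ hk (hab γ) hb (haθ γ) hbθ (haγ γ) h1
        (by rw [h3, ← hlr]) (hrθ γ)).1
      rw [← this] at h1
      exact h1 hbγ
    · obtain ⟨δ, h1, -, h3⟩ := exists_of_coeff_apply_ne_zero hX hφ hk hb hbγ
      -- The pairing for `φ⁻¹`, applied to `φ (a γ)` and `φ b` at `γ`, shows that `θ γ` does not
      -- depend on the chosen `a γ`.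
      have hδ : θ γ = δ := (coeff_apply_pairing hG hφ' hl hφa hφb (haγ γ) hbγ
        (by rw [StarAlgEquiv.symm_apply_apply]; exact haθ γ)
        (by rwa [StarAlgEquiv.symm_apply_apply]) (by rw [hrθ, h3]) hlr).1
      subst hδ
      have h4 := (coeff_apply_pairing hG hφ hk (hab γ) hb (haθ γ) h1 (haγ γ) hbγ rfl (hrθ γ)).2
      have h5 := hpair γ
      have h6 := haθ γ
      have h7 := star_ne_zero.2 (haγ γ)
      rw [div_mul_eq_mul_div, eq_div_iff h6]
      refine mul_left_cancel₀ h7 ?_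
      linear_combination coeff (a γ) (θ γ) * h4 - coeff b (θ γ) * h5
  intro b γ
  refine eq_of_eqOn_toCStar (p := fun b => coeff (φ b) γ)
    (q := fun b => coeff (φ (a γ)) γ / coeff (a γ) (θ γ) * coeff b (θ γ))
    ((coeffL γ).continuous.comp (continuous_starAlgEquiv φ))
    (continuous_const.mul (coeffL _).continuous) (fun f => ?_) b
  obtain ⟨n, g, rfl, hg⟩ := exists_sum_bisection f
  simp only [map_sum, coeff_sum]
  rw [Finset.mul_sum]
  refine Finset.sum_congr rfl fun i _ => hB _ ((hg i).mono fun α hα => ?_) γ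
  rwa [Function.mem_support, coeff_toCStar] at hα

end

end Automorphism

/-! ### The topological and algebraic data of a weighted composition operator -/

section Weighted

variable {G : Type*} [TopologicalSpace G] [ArrowGroupoid G] [IsEtale G] [T2Space G]
  [LocallyCompactSpace G] {φ : ReducedCStar G ≃⋆ₐ[ℂ] ReducedCStar G} {k θ : G → G} {w : G → Circle}

namespace IsWeightedComp

theorem coeff_ne_zero_iff (h : IsWeightedComp φ k θ w) {a : ReducedCStar G} {γ : G} :
    coeff (φ a) γ ≠ 0 ↔ coeff a (θ γ) ≠ 0 := by
  rw [h.coeff_eq, mul_ne_zero_iff_left (Circle.coe_ne_zero _)]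

/-- The `θ`-preimage of the support of `f` is the support of `φ f`, which is open, and supports of
bumps form a neighbourhood basis. -/
theorem continuous_map (h : IsWeightedComp φ k θ w) : Continuous θ := by
  refine continuous_iff_continuousAt.2 fun γ => ?_
  rw [ContinuousAt, tendsto_nhds]
  intro U hU hγ
  obtain ⟨f, hf1, hf0⟩ := exists_bump hU hγ
  filter_upwards [(isOpen_support_coeff (φ (toCStar f))).mem_nhds (x := γ)
    (h.coeff_ne_zero_iff.2 (by rw [coeff_toCStar, hf1]; exact one_ne_zero))] with δ hδ
  have := h.coeff_ne_zero_iff.1 hδ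
  rw [coeff_toCStar] at this
  exact not_imp_comm.1 (hf0 _) this

theorem continuous_weight (h : IsWeightedComp φ k θ w) : Continuous w := by
  refine continuous_induced_rng.2 (continuous_iff_continuousAt.2 fun γ => ?_)
  obtain ⟨f, hf1, -⟩ := exists_bump isOpen_univ (Set.mem_univ (θ γ))
  have hc : Continuous fun δ => coeff (toCStar f) (θ δ) :=
    (continuous_coeff _).comp h.continuous_map
  have hγ : coeff (toCStar f) (θ γ) ≠ 0 := by rw [coeff_toCStar, hf1]; exact one_ne_zero
  refine ((continuous_coeff (φ (toCStar f))).continuousAt.div hc.continuousAt hγ).congr ?_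
  filter_upwards [(isOpen_ne_fun hc continuous_const).mem_nhds hγ] with δ hδ
  rw [Pi.div_apply, h.coeff_eq, mul_div_cancel_right₀ _ hδ]
  rfl

theorem leftInverse {l η : G → G} {v : G → Circle} (h : IsWeightedComp φ k θ w)
    (h' : IsWeightedComp φ.symm l η v) (γ : G) : θ (η γ) = γ := by
  refine (cc_separates fun f hf => ?_).symm
  rw [← coeff_toCStar, ← φ.symm_apply_apply (toCStar f), h'.coeff_eq, h.coeff_eq, coeff_toCStar, hf,
    mul_zero, mul_zero]

/-- With `f`, `g` bumps on bisections at `θ α`, `θ β`, the value of `φ (f g)` at `αβ` is `w α * w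
β`. It is non-zero, so `θ (αβ)` factors through the supports of `f` and `g`; sources and ranges
identify the factors as `θ α` and `θ β`. -/
theorem map_mul (hG : IsEffective G) (hφ : φ ∈ starAutPreserving (czeroUnits G))
    (h : IsWeightedComp φ k θ w) {α β : G} (hαβ : d α = r β) :
    θ (mul α β) = mul (θ α) (θ β) ∧ w (mul α β) = w α * w β := by
  obtain ⟨f, hf1, hfb⟩ := exists_bisection_bump (θ α)
  obtain ⟨g, hg1, hgb⟩ := exists_bisection_bump (θ β)
  rw [← funext (coeff_toCStar f)] at hfb
  rw [← funext (coeff_toCStar g)] at hgb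
  have hf : coeff (toCStar f) (θ α) = 1 := by rw [coeff_toCStar, hf1]
  have hg : coeff (toCStar g) (θ β) = 1 := by rw [coeff_toCStar, hg1]
  have h1 : coeff (φ (toCStar f * toCStar g)) (mul α β) = w α * w β := by
    rw [_root_.map_mul, coeff_mul_of_isBisection (isBisection_support_coeff_apply hG hφ hgb)
      (d_mul' _ _ hαβ) (h.coeff_ne_zero_iff.2 (by rw [hg]; exact one_ne_zero)),
      mul_inv_cancel_right hαβ, h.coeff_eq, h.coeff_eq, hf, hg, mul_one, mul_one]
  have h2 : coeff (toCStar f * toCStar g) (θ (mul α β)) ≠ 0 := by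
    rw [← h.coeff_ne_zero_iff, h1]
    exact mul_ne_zero (Circle.coe_ne_zero _) (Circle.coe_ne_zero _)
  obtain ⟨β', hd, hβ', hα'⟩ := exists_of_coeff_mul_ne_zero hgb h2
  have eβ : β' = θ β := hgb.1 hβ' (show coeff (toCStar g) (θ β) ≠ 0 by rw [hg]; exact one_ne_zero)
    (by rw [← hd, h.d_eq, h.d_eq, d_mul' _ _ hαβ])
  subst eβ
  have eα : mul (θ (mul α β)) (inv (θ β)) = θ α :=
    hfb.2 hα' (show coeff (toCStar f) (θ α) ≠ 0 by rw [hf]; exact one_ne_zero)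
      (by rw [r_mul_inv hd, h.r_eq, h.r_eq, r_mul' _ _ hαβ])
  refine ⟨by rw [← eα, inv_mul_cancel_right hd], Circle.ext ?_⟩
  rw [h.coeff_eq, coeff_mul_of_isBisection hgb hd hβ', eα, hf, hg, mul_one, mul_one] at h1
  rw [h1, Circle.coe_mul]

theorem isHom (hG : IsEffective G) (hφ : φ ∈ starAutPreserving (czeroUnits G))
    (h : IsWeightedComp φ k θ w) : IsHom G θ := fun α β hαβ =>
  ⟨by rw [h.d_eq, h.r_eq, hαβ], (h.map_mul hG hφ hαβ).1⟩

end IsWeightedComp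

theorem exists_eq_twist (hG : IsEffective G) (hφ : φ ∈ starAutPreserving (czeroUnits G)) :
    ∃ p : AutSemidirect G, ∀ f : C_c(G, ℂ), φ (toCStar f) = toCStar (twist p.aut p.coc f) := by
  have hφ' := symm_mem_starAutPreserving hφ
  obtain ⟨k, θ, w, h⟩ := exists_weighted_comp hG hφ
  obtain ⟨l, η, v, h'⟩ := exists_weighted_comp hG hφ'
  have hθη : ∀ γ, θ (η γ) = γ := h.leftInverse h'
  have hηθ : ∀ γ, η (θ γ) = γ := h'.leftInverse (φ := φ.symm) h
  let Φ : G ≃ₜ G :=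
    { toFun := η
      invFun := θ
      left_inv := hθη
      right_inv := hηθ
      continuous_toFun := h'.continuous_map
      continuous_invFun := h.continuous_map }
  have hη := h'.isHom hG hφ'
  let c : C(G, Circle) := ⟨w ∘ η, h.continuous_weight.comp h'.continuous_map⟩
  refine ⟨⟨⟨Φ, hη⟩, ⟨c, fun α β hαβ => ?_⟩⟩, fun f => coeff_ext fun γ => ?_⟩
  · change w (η (mul α β)) = w (η α) * w (η β)
    rw [(hη α β hαβ).2, (h.map_mul hG hφ (hη α β hαβ).1).2]
  · rw [h.coeff_eq, coeff_toCStar, coeff_toCStar]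
    change _ = (w (η (θ γ)) : ℂ) * f (θ γ)
    rw [hηθ]

end Weighted

/-! ### The automorphism attached to a groupoid automorphism and a cocycle -/

section Conjugation

/-- The kernels are conjugate under the unitary that relabels the basis by `e` and multiplies by the
phases `u`. One inequality suffices, as twists are invertible. -/
theorem norm_kernelOp_le_of_conj {ι κ : Type*} (e : ι ≃ κ) (u : ι → Circle) {k : ι → ι → ℂ}
    {k' : κ → κ → ℂ} (h : ∀ a b, k a b = u a * k' (e a) (e b) * star (u b : ℂ))
    (hk : ∃ N C, IsBanded k N C) (hk' : ∃ N C, IsBanded k' N C) :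
    ‖kernelOp k hk‖ ≤ ‖kernelOp k' hk'‖ := by
  refine ContinuousLinearMap.opNorm_le_bound _ (norm_nonneg _) fun ξ => ?_
  have hu : ∀ a (z : ℂ), ‖star (u a : ℂ) * z‖ = ‖z‖ := fun a z => by
    rw [norm_mul, norm_star, Circle.norm_coe, one_mul]
  have hsum : ∀ F : Finset κ, ∑ b ∈ F, ‖star (u (e.symm b) : ℂ) * ξ (e.symm b)‖ ^ 2 ≤ ‖ξ‖ ^ 2 := by
    intro F
    simp only [hu]
    have := lp.sum_rpow_le_norm_rpow (p := 2) (by norm_num) ξ (F.map e.symm.toEmbedding)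
    simpa only [ENNReal.toReal_ofNat, Real.rpow_ofNat, Finset.sum_map, Equiv.coe_toEmbedding]
      using this
  let η : ellTwo κ := ⟨fun b => star (u (e.symm b) : ℂ) * ξ (e.symm b),
    memℓp_gen' (C := ‖ξ‖ ^ 2) fun F => by
      simpa only [ENNReal.toReal_ofNat, Real.rpow_ofNat] using hsum F⟩
  have hη : ‖η‖ ≤ ‖ξ‖ := lp.norm_le_of_forall_sum_le (by norm_num) (norm_nonneg _) fun F => by
    simpa only [ENNReal.toReal_ofNat, Real.rpow_ofNat] using hsum F
  have hval : ∀ a, kernelOp k hk ξ a = u a * kernelOp k' hk' η (e a) := by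
    intro a
    rw [kernelOp_apply, kernelOp_apply, ← e.tsum_eq, ← tsum_mul_left]
    refine tsum_congr fun b => ?_
    change _ = (u a : ℂ) * (k' (e a) (e b) * (star (u (e.symm (e b)) : ℂ) * ξ (e.symm (e b))))
    rw [e.symm_apply_apply, h]
    ring
  refine lp.norm_le_of_forall_sum_le (by norm_num) (by positivity) fun F => ?_
  simp only [ENNReal.toReal_ofNat, Real.rpow_ofNat]
  have h1 := lp.sum_rpow_le_norm_rpow (p := 2) (by norm_num) (kernelOp k' hk' η)
    (F.map e.toEmbedding)
  simp only [ENNReal.toReal_ofNat, Real.rpow_ofNat, Finset.sum_map, Equiv.coe_toEmbedding] at h1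
  calc ∑ a ∈ F, ‖kernelOp k hk ξ a‖ ^ 2 = ∑ a ∈ F, ‖kernelOp k' hk' η (e a)‖ ^ 2 := by
        refine Finset.sum_congr rfl fun a _ => ?_
        rw [hval, norm_mul, Circle.norm_coe, one_mul]
    _ ≤ ‖kernelOp k' hk' η‖ ^ 2 := h1
    _ ≤ (‖kernelOp k' hk'‖ * ‖ξ‖) ^ 2 := by
        gcongr
        exact (ContinuousLinearMap.le_opNorm _ _).trans (by gcongr)

end Conjugation

/-! ### The action of `Aut(G) ⋉ Z(G, 𝕋)` on `C_c(G)` and its extension to `C*_r(G)`. -/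

section Twist

variable {G : Type*} [TopologicalSpace G] [ArrowGroupoid G]

theorem IsHom.map_inv {Φ : G → G} (h : IsHom G Φ) (α : G) : Φ (inv α) = inv (Φ α) := by
  have h1 := h (inv α) α (d_inv α)
  refine eq_inv_of_mul_eq h1.1 ?_
  rw [← h1.2, inv_mul, ← h.map_d]
  exact d_mem _

theorem isHom_symm (Φ : autGroup G) : IsHom G (Φ : G ≃ₜ G).symm := (Φ⁻¹).2

theorem cocycle_inv (c : cocycles G) (α : G) : c.1 (inv α) = (c.1 α)⁻¹ := by
  have h1 := c.2 (d α) (d α) (by rw [d_unit _ (d_mem α), r_unit _ (d_mem α)])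
  rw [r_mul_of_eq (r_unit _ (d_mem α)).symm, right_eq_mul] at h1
  have h2 := c.2 (inv α) α (d_inv α)
  rw [inv_mul, h1] at h2
  exact eq_inv_of_mul_eq_one_left h2.symm

theorem twist_apply (Φ : autGroup G) (c : cocycles G) (f : C_c(G, ℂ)) (α : G) :
    twist Φ c f α = (c.1 (Φ.1.symm α) : ℂ) * f (Φ.1.symm α) := rfl

theorem twist_mul (p q : AutSemidirect G) (f : C_c(G, ℂ)) :
    twist (p * q).aut (p * q).coc f = twist p.aut p.coc (twist q.aut q.coc f) := by
  ext α
  simp only [twist_apply]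
  change (((p.coc.1 (q.aut.1 (q.aut.1.symm (p.aut.1.symm α))) *
    q.coc.1 (q.aut.1.symm (p.aut.1.symm α)) : Circle)) : ℂ) *
    f (q.aut.1.symm (p.aut.1.symm α)) = _
  rw [Homeomorph.apply_symm_apply, Circle.coe_mul, mul_assoc]

theorem twist_one (f : C_c(G, ℂ)) :
    twist (1 : AutSemidirect G).aut (1 : AutSemidirect G).coc f = f := by
  ext α
  exact (congrArg (· * f α) Circle.coe_one).trans (one_mul _)

/-- `twist` as a linear automorphism of `C_c(G)`. -/
noncomputable def twistEquiv (p : AutSemidirect G) : C_c(G, ℂ) ≃ₗ[ℂ] C_c(G, ℂ) where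
  toFun := twist p.aut p.coc
  map_add' f g := by
    ext α
    exact mul_add _ _ _
  map_smul' z f := by
    ext α
    exact mul_left_comm _ _ _
  invFun := twist p⁻¹.aut p⁻¹.coc
  left_inv f := by rw [← twist_mul, inv_mul_cancel, twist_one]
  right_inv f := by rw [← twist_mul, mul_inv_cancel, twist_one]

variable [IsEtale G] [T2Space G]

theorem twist_conv (Φ : autGroup G) (c : cocycles G) (f g : C_c(G, ℂ)) :
    twist Φ c (conv f g) = conv (twist Φ c f) (twist Φ c g) := by
  ext γ
  have hΦ := isHom_symm Φ
  rw [twist_apply]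
  change _ * convFun f g _ = convFun (twist Φ c f) (twist Φ c g) γ
  rw [convFun_eq, convFun_eq, ← tsum_mul_left]
  let e : {α : G // r α = r γ} ≃ {α : G // r α = r (Φ.1.symm γ)} :=
    Φ.1.symm.toEquiv.subtypeEquiv fun α => by
      change r α = r γ ↔ r (Φ.1.symm α) = r (Φ.1.symm γ)
      rw [hΦ.map_r, hΦ.map_r, Φ.1.symm.injective.eq_iff]
  rw [← e.tsum_eq]
  refine tsum_congr fun α => ?_
  change (c.1 (Φ.1.symm γ) : ℂ) * (f (Φ.1.symm α.1) *
    g (mul (inv (Φ.1.symm α.1)) (Φ.1.symm γ))) = (c.1 (Φ.1.symm α.1) * f (Φ.1.symm α.1)) *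
    (c.1 (Φ.1.symm (mul (inv α.1) γ)) * g (Φ.1.symm (mul (inv α.1) γ)))
  have hαγ : d (inv α.1) = r γ := (d_inv _).trans α.2
  obtain ⟨h1, h2⟩ := hΦ (inv α.1) γ hαγ
  rw [hΦ.map_inv] at h1 h2
  rw [h2, c.2 _ _ h1, cocycle_inv, Circle.coe_mul, Circle.coe_inv]
  field_simp [Circle.coe_ne_zero]

theorem twist_invol (Φ : autGroup G) (c : cocycles G) (f : C_c(G, ℂ)) :
    twist Φ c (invol f) = invol (twist Φ c f) := by
  ext γ
  change (c.1 (Φ.1.symm γ) : ℂ) * star (f (inv (Φ.1.symm γ))) =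
    star ((c.1 (Φ.1.symm (inv γ)) : ℂ) * f (Φ.1.symm (inv γ)))
  rw [(isHom_symm Φ).map_inv, cocycle_inv, star_mul', Circle.coe_inv_eq_conj]
  simp

/-- `Φ⁻¹` carries the fibre over `x` onto the fibre over `y = Φ⁻¹(x)`, and the cocycle identity
splits `c` of `αβ⁻¹` into a phase in `α` times the conjugate phase in `β`. So `λ_x` of the twist is
conjugate to `λ_y f`. -/
theorem norm_toCStar_twist_le (Φ : autGroup G) (c : cocycles G) (f : C_c(G, ℂ)) :
    ‖toCStar (twist Φ c f)‖ ≤ ‖toCStar f‖ := by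
  have hΦ := isHom_symm Φ
  rw [norm_toCStar]
  refine Real.iSup_le (fun x => ?_) (norm_nonneg _)
  have hy : Φ.1.symm x.1 ∈ (units : Set G) := by
    rw [← d_unit _ x.2, ← hΦ.map_d]
    exact d_mem _
  let y : units (G := G) := ⟨Φ.1.symm x.1, hy⟩
  refine le_trans ?_ ((congrArg norm (fibreRep_toCStar y f)).symm.le.trans
    (norm_fibreRep_apply_le y (toCStar f)))
  let e : Fibre x ≃ Fibre y := Φ.1.symm.toEquiv.subtypeEquiv fun α => by
    change d α = x.1 ↔ d (Φ.1.symm α) = Φ.1.symm x.1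
    rw [hΦ.map_d, Φ.1.symm.injective.eq_iff]
  refine norm_kernelOp_le_of_conj e (fun α => c.1 (Φ.1.symm α.1)) (fun α β => ?_) _ _
  have hαβ : d α.1 = r (inv β.1) := (α.2.trans β.2.symm).trans (r_inv _).symm
  obtain ⟨h1, h2⟩ := hΦ _ _ hαβ
  rw [hΦ.map_inv] at h1 h2
  change (c.1 (Φ.1.symm (mul α.1 (inv β.1))) : ℂ) * f (Φ.1.symm (mul α.1 (inv β.1))) =
    c.1 (Φ.1.symm α.1) * f (mul (Φ.1.symm α.1) (inv (Φ.1.symm β.1))) *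
    star (c.1 (Φ.1.symm β.1) : ℂ)
  rw [h2, c.2 _ _ h1, cocycle_inv, Circle.coe_mul, Circle.coe_inv_eq_conj]
  exact mul_right_comm _ _ _

theorem norm_toCStar_twistEquiv (p : AutSemidirect G) (f : C_c(G, ℂ)) :
    ‖toCStar (twistEquiv p f)‖ = ‖toCStar f‖ := by
  refine le_antisymm (norm_toCStar_twist_le _ _ f) ?_
  have h := norm_toCStar_twist_le p⁻¹.aut p⁻¹.coc (twistEquiv p f)
  rwa [show twist p⁻¹.aut p⁻¹.coc (twistEquiv p f) = f from (twistEquiv p).left_inv f] at h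

/-- The extension of `twistEquiv` to `C*_r(G)`. -/
noncomputable def twistIsometry (p : AutSemidirect G) : ReducedCStar G ≃ₗᵢ[ℂ] ReducedCStar G :=
  (twistEquiv p).extendOfIsometry toCStar toCStar denseRange_toCStar denseRange_toCStar
    (norm_toCStar_twistEquiv p)

theorem twistIsometry_toCStar (p : AutSemidirect G) (f : C_c(G, ℂ)) :
    twistIsometry p (toCStar f) = toCStar (twist p.aut p.coc f) :=
  LinearEquiv.extendOfIsometry_eq ..

/-- The *-automorphism `φ_{Φ,c}` of `C*_r(G)`. -/
noncomputable def twistAut (p : AutSemidirect G) : ReducedCStar G ≃⋆ₐ[ℂ] ReducedCStar G where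
  toFun := twistIsometry p
  invFun := (twistIsometry p).symm
  left_inv := (twistIsometry p).symm_apply_apply
  right_inv := (twistIsometry p).apply_symm_apply
  map_add' := map_add (twistIsometry p)
  map_smul' := map_smul (twistIsometry p)
  map_mul' a b := by
    have hc := (twistIsometry p).continuous
    refine denseRange_toCStar.induction_on₂ (isClosed_eq (by fun_prop) (by fun_prop))
      (fun f g => ?_) a b
    rw [← toCStar_conv, twistIsometry_toCStar, twist_conv, toCStar_conv, twistIsometry_toCStar,
      twistIsometry_toCStar]
  map_star' a := by
    have hc := (twistIsometry p).continuous
    refine eq_of_eqOn_toCStar (p := fun a => twistIsometry p (star a))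
      (q := fun a => star (twistIsometry p a)) (by fun_prop) (by fun_prop) (fun f => ?_) a
    rw [← toCStar_invol, twistIsometry_toCStar, twist_invol, toCStar_invol, twistIsometry_toCStar]

theorem twistAut_toCStar (p : AutSemidirect G) (f : C_c(G, ℂ)) :
    twistAut p (toCStar f) = toCStar (twist p.aut p.coc f) :=
  twistIsometry_toCStar p f

theorem starAlgEquiv_ext {φ ψ : ReducedCStar G ≃⋆ₐ[ℂ] ReducedCStar G}
    (h : ∀ f : C_c(G, ℂ), φ (toCStar f) = ψ (toCStar f)) : φ = ψ :=
  StarAlgEquiv.ext fun a =>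
    eq_of_eqOn_toCStar (continuous_starAlgEquiv φ) (continuous_starAlgEquiv ψ) h a

theorem twistAut_mul (p q : AutSemidirect G) : twistAut (p * q) = twistAut p * twistAut q := by
  refine starAlgEquiv_ext fun f => ?_
  change _ = twistAut p (twistAut q (toCStar f))
  rw [twistAut_toCStar, twistAut_toCStar, twistAut_toCStar, twist_mul]

theorem twistAut_one : twistAut (1 : AutSemidirect G) = 1 := by
  refine starAlgEquiv_ext fun f => ?_
  rw [twistAut_toCStar, twist_one]
  rfl

theorem twistAut_apply_mem (p : AutSemidirect G) {a : ReducedCStar G} (ha : a ∈ czeroUnits G) :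
    twistAut p a ∈ czeroUnits G := by
  refine closure_minimal (t := twistAut p ⁻¹' (czeroUnits G : Set (ReducedCStar G))) ?_
    ((ccUnits G).isClosed_topologicalClosure.preimage (continuous_starAlgEquiv _)) ha
  rintro _ ⟨f, hf, rfl⟩
  rw [Set.mem_preimage, twistAut_toCStar]
  refine toCStar_mem_czeroUnits fun α hα => ?_
  rw [twist_apply, hf _ fun h => hα ?_, mul_zero]
  rw [← p.aut.1.apply_symm_apply α, ← d_unit _ h, ← IsHom.map_d p.aut.2]
  exact d_mem _

theorem twistAut_mem (p : AutSemidirect G) : twistAut p ∈ starAutPreserving (czeroUnits G) := by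
  change twistAut p '' (czeroUnits G : Set (ReducedCStar G)) = czeroUnits G
  refine Set.Subset.antisymm (Set.image_subset_iff.2 fun a ha => twistAut_apply_mem p ha)
    fun a ha => ⟨twistAut p⁻¹ a, twistAut_apply_mem p⁻¹ ha, ?_⟩
  change (twistAut p * twistAut p⁻¹) a = a
  rw [← twistAut_mul, mul_inv_cancel, twistAut_one]
  rfl

theorem toCStar_injective : Function.Injective (toCStar : C_c(G, ℂ) → ReducedCStar G) :=
  fun f g h => by
    ext γ
    rw [← coeff_toCStar, h, coeff_toCStar]

/-- Phases never vanish, so the zeros of twisted functions determine `Φ⁻¹`. A bump equal to 1 at `γ`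
then recovers `c γ`. -/
theorem twistAut_injective [LocallyCompactSpace G] :
    Function.Injective (twistAut : AutSemidirect G → _) := by
  intro p q h
  have hpq : ∀ f : C_c(G, ℂ), ∀ α, (p.coc.1 (p.aut.1.symm α) : ℂ) * f (p.aut.1.symm α) =
      q.coc.1 (q.aut.1.symm α) * f (q.aut.1.symm α) := fun f α => by
    have := toCStar_injective ((twistAut_toCStar p f).symm.trans
      ((congrArg (fun φ => φ (toCStar f)) h).trans (twistAut_toCStar q f)))
    exact congrArg (fun g : C_c(G, ℂ) => g α) this
  have h1 : ∀ α, p.aut.1.symm α = q.aut.1.symm α := fun α => cc_separates fun f hf => by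
    have := hpq f α
    rw [hf, mul_zero, mul_eq_zero] at this
    exact this.resolve_left (Circle.coe_ne_zero _)
  have h2 : p.aut.1.symm = q.aut.1.symm := Homeomorph.ext h1
  refine AutSemidirect.ext (Subtype.ext (Homeomorph.symm_bijective.injective h2))
    (Subtype.ext (ContinuousMap.ext fun γ => Circle.ext ?_))
  obtain ⟨f, hf1, -⟩ := exists_bump isOpen_univ (Set.mem_univ γ)
  have := hpq f (p.aut.1 γ)
  rwa [← h1, Homeomorph.symm_apply_apply, hf1, mul_one, mul_one] at this

end Twist

end ArrowGroupoid

/-! ### The isomorphism theorem. -/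

theorem mainTheorem4 {G : Type*} [TopologicalSpace G] [T2Space G] [LocallyCompactSpace G]
    [ArrowGroupoid G] [ArrowGroupoid.IsEtale G] (hG : ArrowGroupoid.IsEffective G) :
    (∀ (Φ : ArrowGroupoid.autGroup G) (c : ArrowGroupoid.cocycles G),
      ∃! φ : ArrowGroupoid.ReducedCStar G ≃⋆ₐ[ℂ] ArrowGroupoid.ReducedCStar G,
        ∀ f : C_c(G, ℂ),
          φ (ArrowGroupoid.toCStar f) = ArrowGroupoid.toCStar (ArrowGroupoid.twist Φ c f)) ∧
    ∃ Ψ : ArrowGroupoid.AutSemidirect G ≃*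
        ArrowGroupoid.starAutPreserving (ArrowGroupoid.czeroUnits G),
      ∀ (p : ArrowGroupoid.AutSemidirect G) (f : C_c(G, ℂ)),
        (Ψ p : ArrowGroupoid.ReducedCStar G ≃⋆ₐ[ℂ] ArrowGroupoid.ReducedCStar G)
            (ArrowGroupoid.toCStar f) =
          ArrowGroupoid.toCStar (ArrowGroupoid.twist p.aut p.coc f) := by
  open ArrowGroupoid in
  refine ⟨fun Φ c => ⟨twistAut ⟨Φ, c⟩, twistAut_toCStar _, fun φ hφ => ?_⟩, ?_⟩
  · exact starAlgEquiv_ext fun f => (hφ f).trans (twistAut_toCStar ⟨Φ, c⟩ f).symm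
  · refine ⟨MulEquiv.ofBijective (MonoidHom.mk'
      (fun p => (⟨twistAut p, twistAut_mem p⟩ : starAutPreserving (czeroUnits G)))
      fun p q => Subtype.ext (twistAut_mul p q)) ⟨fun p q h => ?_, fun φ => ?_⟩,
      fun p f => twistAut_toCStar p f⟩
    · exact twistAut_injective (congrArg Subtype.val h)
    · obtain ⟨p, hp⟩ := exists_eq_twist hG φ.2
      exact ⟨p, Subtype.ext (starAlgEquiv_ext fun f => (twistAut_toCStar p f).trans (hp f).symm)⟩
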